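/- Let $p$ be a prime number, $q=p$ if $p$ is odd and $q=4$ if $p=2$. Let $\mathbb{C}_p$ be the completion of an algebraic closure of $\mathbb{Q}_p$, with $|p|=1/p$. Let $\omega$ be the Teichmüller character, i.e. the Dirichlet character modulo $q$ with values in $\mathbb{Z}_p$ such that $\omega(a)\equiv a \pmod q$ for $p\nmid a$, and put $\langle a\rangle=a/\omega(a)$ and $\langle a\rangle^{s}=\sum_{n\ge 0}\binom{s}{n}(\langle a\rangle-1)^n$. Let $\chi$ be an even primitive Dirichlet character of conductor $f$ with values in $\mathbb{C}_p$. The $p$-adic $L$-function $L_p(s,\chi)$ is the function on $\{s\in\mathbb{C}_p : |s|<q\,p^{-1/(p-1)}\}$ characterized as follows: $(s-1)L_p(s,\chi)$ is given for $s\neq 1$ by a power series in $s$ converging on this disc; if $\chi\ne 1$, then $L_p(s,\chi)$ itself is given by such a power series on the whole disc; and $$L_p(1-n,\chi)=-\bigl(1-\chi\omega^{-n}(p)\,p^{n-1}\bigr)\frac{B_{n,\chi\omega^{-n}}}{n}\qquad\text{for all integers } n\ge 1,$$ where $\chi\omega^{-n}$ denotes the associated primitive character and, for a primitive character $\psi$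 of conductor $m$, $B_{n,\psi}=m^{n-1}\sum_{a=1}^{m}\psi(a)B_n(a/m)$ with $B_n(x)$ the Bernoulli polynomials. (For $\chi=1$ the value at $s=1$ is not considered.) **Proposition.** This function $L_p(s,\chi)$ exists. Let $F\ge 1$ be an integer that is a multiple of both $q$ and $f$. Then for all $s\in\mathbb{C}_p$ with $|s|<q\,p^{-1/(p-1)}$ and $s\neq 1$, $$\left|\,L_p(s,\chi)-\frac{1}{F}\,\frac{1}{s-1}\sum_{\substack{a=1\\ p\nmid a}}^{F}\chi(a)\langle a\rangle^{1-s}\right|\le\left|\frac{F}{qp}\right| .$$ If $\chi\neq 1$, the subtracted expression has a limit as $s\to 1$, $s\ne 1$, and the same estimate holds at $s=1$ with the expression replaced by this limit. -/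

import Mathlib

open Filter Topology

/-- The number `q` attached to the prime `p`: `q = 4` if `p = 2`, and `q = p` otherwise. -/
def padicQ (p : ℕ) : ℕ := if p = 2 then 4 else p

theorem exists_teichmullerCharacter (p : ℕ) [Fact p.Prime] :
    ∃ ω : DirichletCharacter ℤ_[p] (padicQ p),
      ∀ a : ℕ, ¬ p ∣ a → (padicQ p : ℤ_[p]) ∣ ω a - a := by
  by_cases h2 : p = 2
  · subst h2
    refine ⟨(ZMod.χ₄.ringHomComp (Int.castRingHom ℤ_[2]) : MulChar (ZMod 4) ℤ_[2]), ?_⟩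
    intro a ha
    have key : ∀ x : ZMod 4, x ≠ 0 → x ≠ 2 → ((ZMod.χ₄ x : ℤ) : ZMod 4) = x := by decide
    have h0 : (a : ZMod 4) ≠ 0 := by
      intro h
      rw [ZMod.natCast_eq_zero_iff] at h
      omega
    have h2 : (a : ZMod 4) ≠ 2 := by
      intro h
      have h' : (a : ZMod 4) = ((2 : ℕ) : ZMod 4) := by simpa using h
      rw [ZMod.natCast_eq_natCast_iff'] at h'
      omega
    have hk := key a h0 h2
    have hd : (4 : ℤ) ∣ ZMod.χ₄ (a : ZMod 4) - a := by
      have : ((ZMod.χ₄ (a : ZMod 4) - a : ℤ) : ZMod 4) = 0 := by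
        push_cast
        rw [hk, sub_self]
      exact (ZMod.intCast_zmod_eq_zero_iff_dvd _ 4).mp this
    obtain ⟨k, hk⟩ := hd
    have hk' := congrArg (fun z : ℤ => (z : ℤ_[2])) hk
    refine ⟨(k : ℤ_[2]), ?_⟩
    push_cast at hk'
    exact hk'
  · have hq : padicQ p = p := if_neg h2
    rw [hq]
    refine ⟨⟨(WittVector.equiv p).toMonoidHom.comp (WittVector.teichmuller p), ?_⟩, ?_⟩
    · intro a ha
      have ha0 : a = 0 := by
        by_contra h
        exact ha (isUnit_iff_ne_zero.mpr h)
      simp [ha0]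
    · intro a _
      change (p : ℤ_[p]) ∣ WittVector.equiv p (WittVector.teichmuller p (a : ZMod p)) - a
      rw [← PadicInt.norm_lt_one_iff_dvd, ← PadicInt.mem_nonunits, mem_nonunits_iff]
      intro hu
      have he : WittVector.equiv p (WittVector.teichmuller p (a : ZMod p)) - a =
          WittVector.equiv p (WittVector.teichmuller p (a : ZMod p) - a) := by
        rw [map_sub, map_natCast (WittVector.equiv p)]
      rw [he] at hu
      have hu' := (MulEquiv.isUnit_map (WittVector.equiv p)).mp hu
      have hc := hu'.map (WittVector.constantCoeff (p := p) (R := ZMod p))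
      rw [map_sub, map_natCast (WittVector.constantCoeff (p := p) (R := ZMod p))] at hc
      simp [WittVector.constantCoeff] at hc

noncomputable section

/-- The Teichmüller character `ω`, as a Dirichlet character modulo `q` with values in `ℂ_p`: the
(unique) one with values in `ℤ_p` and `ω(a) ≡ a` modulo `q` for all `a` prime to `p`. -/
def teichmullerCharacter (p : ℕ) [Fact p.Prime] : DirichletCharacter ℂ_[p] (padicQ p) :=
  (exists_teichmullerCharacter p).choose.ringHomComp
    ((algebraMap ℚ_[p] ℂ_[p]).comp PadicInt.Coe.ringHom)

/-- `⟨a⟩ = a / ω(a)`, for an integer `a` prime to `p`. -/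
def angle (p : ℕ) [Fact p.Prime] (a : ℕ) : ℂ_[p] := a / teichmullerCharacter p a

/-- The radius `q p ^ (-1 / (p - 1))`. -/
def padicLRadius (p : ℕ) : ℝ := padicQ p * (p : ℝ) ^ (-1 / ((p : ℝ) - 1))

/-- The binomial coefficient `s (s - 1) ⋯ (s - n + 1) / n!`. -/
def padicBinom {p : ℕ} [Fact p.Prime] (s : ℂ_[p]) (n : ℕ) : ℂ_[p] :=
  (∏ i ∈ Finset.range n, (s - i)) / (n.factorial : ℂ_[p])

/-- The `p`-adic power `x ^ s = ∑ₙ (s choose n) (x - 1) ^ n`. The series converges for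
`|x - 1| ≤ 1 / q` and `|s| < q p ^ (-1 / (p - 1))`. -/
def padicPow {p : ℕ} [Fact p.Prime] (x s : ℂ_[p]) : ℂ_[p] :=
  ∑' n : ℕ, padicBinom s n * (x - 1) ^ n

/-- The generalized Bernoulli number `B_{n,ψ} = m ^ (n - 1) ∑_{a = 1}^m ψ(a) B_n(a / m)` of a
Dirichlet character `ψ` modulo `m` (it is applied to primitive characters). -/
def generalizedBernoulli {p : ℕ} [Fact p.Prime] {m : ℕ} (n : ℕ)
    (ψ : DirichletCharacter ℂ_[p] m) : ℂ_[p] :=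
  (m : ℂ_[p]) ^ ((n : ℤ) - 1) * ∑ a ∈ Finset.Icc 1 m,
    ψ a * (((Polynomial.bernoulli n).eval ((a : ℚ) / m) : ℚ) : ℂ_[p])

/-- The primitive Dirichlet character attached to `χ ω⁻ⁿ`. -/
def teichmullerTwist {p : ℕ} [Fact p.Prime] {f : ℕ} (χ : DirichletCharacter ℂ_[p] f) (n : ℕ) :
    DirichletCharacter ℂ_[p] (χ.mul (teichmullerCharacter p ^ n)⁻¹).conductor :=
  χ.primitive_mul (teichmullerCharacter p ^ n)⁻¹

/-- `L` is a `p`-adic `L`-function of `χ`: on the disc `|s| < q p ^ (-1 / (p - 1))` it is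
meromorphic with at most a simple pole, at `s = 1`; it is analytic on the whole disc if `χ ≠ 1`;
and `L(1 - n) = - (1 - χω⁻ⁿ(p) p ^ (n - 1)) B_{n,χω⁻ⁿ} / n` for all integers `n ≥ 1`.
These conditions determine `L` on the disc, away from `s = 1` if `χ = 1`. -/
structure IsPadicLFunction {p : ℕ} [Fact p.Prime] {f : ℕ} (χ : DirichletCharacter ℂ_[p] f)
    (L : ℂ_[p] → ℂ_[p]) : Prop where
  meromorphic : ∃ c : ℕ → ℂ_[p], ∀ s : ℂ_[p], ‖s‖ < padicLRadius p → s ≠ 1 →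
    HasSum (fun n : ℕ => c n * s ^ n) ((s - 1) * L s)
  analytic : χ ≠ 1 → ∃ c : ℕ → ℂ_[p], ∀ s : ℂ_[p], ‖s‖ < padicLRadius p →
    HasSum (fun n : ℕ => c n * s ^ n) (L s)
  interpolation : ∀ n : ℕ, 1 ≤ n → L (1 - n) =
    -(1 - teichmullerTwist χ n p * (p : ℂ_[p]) ^ (n - 1)) *
      generalizedBernoulli n (teichmullerTwist χ n) / n

open scoped Classical in
/-- The `p`-adic `L`-function `L_p(s, χ)` of a primitive Dirichlet character `χ`. The default value
`0` is only there to make the definition total. -/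
def padicLFunction {p : ℕ} [Fact p.Prime] {f : ℕ} (χ : DirichletCharacter ℂ_[p] f) :
    ℂ_[p] → ℂ_[p] :=
  if h : ∃ L, IsPadicLFunction χ L then h.choose else 0

/-- `(1 / F) (1 / (s - 1)) ∑_{1 ≤ a ≤ F, p ∤ a} χ(a) ⟨a⟩ ^ (1 - s)`. -/
def kubotaLeopoldtSum {p : ℕ} [Fact p.Prime] {f : ℕ} (χ : DirichletCharacter ℂ_[p] f) (F : ℕ)
    (s : ℂ_[p]) : ℂ_[p] :=
  1 / (F : ℂ_[p]) * (1 / (s - 1)) *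
    ∑ a ∈ (Finset.Icc 1 F).filter (fun a => ¬ p ∣ a), χ a * padicPow (angle p a) (1 - s)

end

/-!
For a common multiple `F` of `q` and `f` put
`H_F(s) = (1 / F) ∑ χ(a) ⟨a⟩ ^ (1 - s) ∑ⱼ (1 - s choose j) Bⱼ (F / a) ^ j`, the outer sum being over
`1 ≤ a ≤ F` with `p ∤ a`. The function `H_F(s) / (s - 1)` is a `p`-adic `L`-function of `χ`:

* Let `R = q p ^ (-1 / (p - 1))`, which is greater than `1`. By Legendre's formula for `n!` and the
  bound `|Bⱼ| ≤ p` of von Staudt and Clausen, the binomial series rearrange into power series in `s`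
  whose coefficients are `O(R ^ (-n))`. By the ultrametric inequality such series are closed under
  products and, if they vanish at `s = 1`, under division by `s - 1`
  (`HasBoundedExpansion.exists_eq_sub_one_mul`). If `χ ≠ 1` then `H_F(1) = 0`, because a nontrivial
  character sums to zero over a period.
* At `s = 1 - n` the inner sum is finite and equals `F ^ n a ^ (-n) B_n(a / F)`. Hence `H_F(1 - n)`
  is `F ^ (n - 1) ∑ χω⁻ⁿ(a) B_n(a / F)`. The multiplication theorem for Bernoulli polynomials
  identifies it with a generalized Bernoulli number, and the condition `p ∤ a` produces the Euler
  factor (`padicLNumerator_one_sub_natCast`).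

The points `-p ^ k = 1 - (p ^ k + 1)` accumulate at `0`, so the interpolation property determines
the power series. All the functions `H_F(s) / (s - 1)`, as well as `padicLFunction χ`, therefore
agree, and the estimate may be proved for the given `F`
(`norm_padicLNumerator_div_sub_le`). The term `j = 0` is `kubotaLeopoldtSum χ F`. The terms `j ≥ 2`
are bounded one by one by `|F / (q p)|`. In the term `j = 1` one pairs `a` with `F - a`: since `χ` is
even and `ω` is odd, the two contributions cancel up to `O(F)`. The estimate at `s = 1` follows by
continuity.
-/

/-! ### Power series with bounded coefficients on an ultrametric disc -/

/-- On the open disc of radius `R` about `0`, the function `g` is the sum of a power series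
`∑ c n * s ^ n` for which `‖c n‖ * R ^ n` is bounded. The boundedness is what makes the class
stable under products and under division by `s - 1`. -/
def HasBoundedExpansion {K : Type*} [NormedField K] (R : ℝ) (g : K → K) : Prop :=
  ∃ c : ℕ → K, (∃ M, ∀ n, ‖c n‖ * R ^ n ≤ M) ∧
    ∀ s, ‖s‖ < R → HasSum (fun n => c n * s ^ n) (g s)

section BoundedExpansion

variable {K : Type*} [NontriviallyNormedField K] {R M : ℝ}

theorem norm_mul_pow_le_geometric {c : ℕ → K} (hR : 0 < R) (hc : ∀ n, ‖c n‖ * R ^ n ≤ M)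
    (s : K) (n : ℕ) : ‖c n * s ^ n‖ ≤ M * (‖s‖ / R) ^ n := by
  have h := hc n
  have hRn : 0 < R ^ n := by positivity
  calc ‖c n * s ^ n‖ = (‖c n‖ * R ^ n) * (‖s‖ / R) ^ n := by
        rw [norm_mul, norm_pow, div_pow]; field_simp
    _ ≤ _ := by gcongr

theorem summable_norm_mul_pow {c : ℕ → K} (hR : 0 < R) (hc : ∀ n, ‖c n‖ * R ^ n ≤ M)
    {s : K} (hs : ‖s‖ < R) : Summable (fun n => ‖c n * s ^ n‖) :=
  Summable.of_nonneg_of_le (fun _ => norm_nonneg _) (norm_mul_pow_le_geometric hR hc s)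
    ((summable_geometric_of_lt_one (by positivity) ((div_lt_one hR).2 hs)).mul_left M)

namespace HasBoundedExpansion

variable {g g' : K → K}

theorem congr (h : HasBoundedExpansion R g) (hg : ∀ s, ‖s‖ < R → g s = g' s) :
    HasBoundedExpansion R g' := by
  obtain ⟨c, hM, hs⟩ := h
  exact ⟨c, hM, fun s h => hg s h ▸ hs s h⟩

theorem add (hR : 0 < R) (h : HasBoundedExpansion R g) (h' : HasBoundedExpansion R g') :
    HasBoundedExpansion R (fun s => g s + g' s) := by
  obtain ⟨c, ⟨M, hM⟩, hs⟩ := h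
  obtain ⟨c', ⟨M', hM'⟩, hs'⟩ := h'
  refine ⟨fun n => c n + c' n, ⟨M + M', fun n => ?_⟩, fun s h => ?_⟩
  · refine le_trans ?_ (add_le_add (hM n) (hM' n))
    rw [← add_mul]
    gcongr
    exact norm_add_le _ _
  · simpa [add_mul] using (hs s h).add (hs' s h)

theorem const_mul (a : K) (h : HasBoundedExpansion R g) :
    HasBoundedExpansion R (fun s => a * g s) := by
  obtain ⟨c, ⟨M, hM⟩, hs⟩ := h
  refine ⟨fun n => a * c n, ⟨‖a‖ * M, fun n => ?_⟩, fun s h => ?_⟩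
  · rw [norm_mul, mul_assoc]
    exact mul_le_mul_of_nonneg_left (hM n) (norm_nonneg _)
  · simpa [mul_assoc] using (hs s h).mul_left a

theorem sum (hR : 0 < R) {ι : Type*} (t : Finset ι) {G : ι → K → K}
    (h : ∀ i ∈ t, HasBoundedExpansion R (G i)) :
    HasBoundedExpansion R (fun s => ∑ i ∈ t, G i s) := by
  classical
  induction t using Finset.induction_on with
  | empty => exact ⟨fun _ => 0, ⟨0, by simp⟩, fun s _ => by simp⟩
  | insert i t hi ih =>
    simp only [Finset.sum_insert hi]
    exact (h i (by simp)).add hR (ih fun j hj => h j (by simp [hj]))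

theorem mul [CompleteSpace K] [IsUltrametricDist K] (hR : 0 < R)
    (h : HasBoundedExpansion R g) (h' : HasBoundedExpansion R g') :
    HasBoundedExpansion R (fun s => g s * g' s) := by
  obtain ⟨c, ⟨M, hM⟩, hs⟩ := h
  obtain ⟨c', ⟨M', hM'⟩, hs'⟩ := h'
  have hM0 : 0 ≤ M := (by positivity : 0 ≤ ‖c 0‖ * R ^ 0).trans (hM 0)
  have hM0' : 0 ≤ M' := (by positivity : 0 ≤ ‖c' 0‖ * R ^ 0).trans (hM' 0)
  refine ⟨fun n => ∑ k ∈ Finset.range (n + 1), c k * c' (n - k), ⟨M * M', fun n => ?_⟩,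
    fun s h => ?_⟩
  · rw [← le_div_iff₀ (by positivity)]
    refine IsUltrametricDist.norm_sum_le_of_forall_le_of_nonneg (by positivity) fun k hk => ?_
    have hk' : k ≤ n := Nat.lt_succ_iff.1 (Finset.mem_range.1 hk)
    rw [le_div_iff₀ (by positivity), norm_mul]
    calc ‖c k‖ * ‖c' (n - k)‖ * R ^ n
        = (‖c k‖ * R ^ k) * (‖c' (n - k)‖ * R ^ (n - k)) := by
          rw [show R ^ n = R ^ k * R ^ (n - k) by rw [← pow_add, Nat.add_sub_cancel' hk']]; ring
      _ ≤ M * M' := mul_le_mul (hM k) (hM' _) (by positivity) hM0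
  · have e1 := summable_norm_mul_pow hR hM h
    have e2 := summable_norm_mul_pow hR hM' h
    have := tsum_mul_tsum_eq_tsum_sum_range_of_summable_norm e1 e2
    rw [(hs s h).tsum_eq, (hs' s h).tsum_eq] at this
    simp only [this]
    have hsum := (summable_norm_sum_mul_range_of_summable_norm e1 e2).of_norm.hasSum
    refine (funext fun n => ?_ : (fun n => (∑ k ∈ Finset.range (n + 1), c k * c' (n - k)) * s ^ n) =
      _) ▸ hsum
    rw [Finset.sum_mul]
    refine Finset.sum_congr rfl fun k hk => ?_
    have hk' : k ≤ n := Nat.lt_succ_iff.1 (Finset.mem_range.1 hk)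
    rw [show s ^ n = s ^ k * s ^ (n - k) by rw [← pow_add, Nat.add_sub_cancel' hk']]
    ring

theorem continuousAt [CompleteSpace K] (h : HasBoundedExpansion R g) (hR : 0 < R) {s : K}
    (hs : ‖s‖ < R) : ContinuousAt g s := by
  obtain ⟨c, ⟨M, hM⟩, hsum⟩ := h
  obtain ⟨r, hr, hrR⟩ := exists_between hs
  have hr0 : 0 ≤ r := (norm_nonneg s).trans hr.le
  have hU : Metric.ball (0 : K) r ∈ 𝓝 s := Metric.isOpen_ball.mem_nhds (by simpa using hr)
  have hcont : ContinuousOn (fun s : K => ∑' n, c n * s ^ n) (Metric.ball (0 : K) r) := by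
    refine continuousOn_tsum (u := fun n => M * (r / R) ^ n) (fun n => by fun_prop)
      ((summable_geometric_of_lt_one (by positivity) ((div_lt_one hR).2 hrR)).mul_left M) ?_
    intro n x hx
    refine (norm_mul_pow_le_geometric hR hM x n).trans ?_
    have hx' : ‖x‖ ≤ r := by simpa using (Metric.mem_ball.1 hx).le
    have hM0 : 0 ≤ M := (by positivity : 0 ≤ ‖c 0‖ * R ^ 0).trans (hM 0)
    gcongr
  refine (hcont.continuousAt hU).congr ?_
  filter_upwards [hU] with x hx
  exact (hsum x (lt_trans (by simpa using hx) hrR)).tsum_eq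

/-- Division by `s - 1`: the quotient has the coefficients `d n = ∑ k, c (n + 1 + k)`, and the
ultrametric inequality gives them the bound satisfied by the `c n`. -/
theorem exists_eq_sub_one_mul [CompleteSpace K] [IsUltrametricDist K] (hR : 1 < R)
    (h : HasBoundedExpansion R g) (h1 : g 1 = 0) :
    ∃ G, HasBoundedExpansion R G ∧ ∀ s, ‖s‖ < R → g s = (s - 1) * G s := by
  obtain ⟨c, ⟨M, hM⟩, hsum⟩ := h
  have hR0 : 0 < R := one_pos.trans hR
  have hM0 : 0 ≤ M := (by positivity : 0 ≤ ‖c 0‖ * R ^ 0).trans (hM 0)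
  have hc : HasSum c 0 := by simpa [h1] using hsum 1 (by simpa using hR)
  set d : ℕ → K := fun n => ∑' k, c (k + (n + 1)) with hd
  have hdM : ∀ n, ‖d n‖ * R ^ n ≤ M := by
    intro n
    rw [← le_div_iff₀ (by positivity)]
    refine IsUltrametricDist.norm_tsum_le_of_forall_le fun k => ?_
    rw [le_div_iff₀ (by positivity)]
    refine le_trans ?_ (hM (k + (n + 1)))
    gcongr
    · exact hR.le
    · omega
  have hd0 : d 0 = - c 0 := by
    have := hc.summable.sum_add_tsum_nat_add 1
    rw [hc.tsum_eq, Finset.sum_range_one] at this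
    exact eq_neg_of_add_eq_zero_right this
  have hdS : ∀ n, d n = c (n + 1) + d (n + 1) := by
    intro n
    have := ((summable_nat_add_iff (n + 1)).2 hc.summable).tsum_eq_zero_add
    simp only [hd]
    rw [this]
    congr 2
    · ring_nf
    · ext k; ring_nf
  refine ⟨fun s => ∑' n, d n * s ^ n, ⟨d, ⟨M, hdM⟩, fun s hs =>
    (summable_norm_mul_pow hR0 hdM hs).of_norm.hasSum⟩, fun s hs => ?_⟩
  have hS := (summable_norm_mul_pow hR0 hdM hs).of_norm
  have hS1 := (summable_nat_add_iff 1).2 hS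
  have eD : ∑' n, d n * s ^ n = d 0 * s ^ 0 + ∑' n, d (n + 1) * s ^ (n + 1) :=
    hS.tsum_eq_zero_add
  have eC : g s = c 0 * s ^ 0 + ∑' n, c (n + 1) * s ^ (n + 1) := by
    rw [← (hsum s hs).tsum_eq]
    exact (hsum s hs).summable.tsum_eq_zero_add
  have eS : ∑' n, c (n + 1) * s ^ (n + 1) =
      s * ∑' n, d n * s ^ n - ∑' n, d (n + 1) * s ^ (n + 1) := by
    rw [← tsum_mul_left, ← (hS.mul_left s).tsum_sub hS1]
    refine tsum_congr fun n => ?_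
    rw [hdS n]
    ring
  calc g s = s * ∑' n, d n * s ^ n - (d 0 * s ^ 0 + ∑' n, d (n + 1) * s ^ (n + 1)) := by
        rw [eC, eS, hd0]; ring
    _ = (s - 1) * ∑' n, d n * s ^ n := by rw [← eD]; ring

/-- A series of polynomials `P n` of degree at most `n`, with coefficients `O(R ^ (-n))`, can be
rearranged into a power series. -/
theorem of_polynomials [CompleteSpace K] [IsUltrametricDist K] (hR : 1 < R)
    {P : ℕ → Polynomial K} (hdeg : ∀ n, (P n).natDegree ≤ n)
    (hP : ∀ n k, ‖(P n).coeff k‖ * R ^ n ≤ M) :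
    HasBoundedExpansion R (fun s => ∑' n, (P n).eval s) := by
  have hR0 : 0 < R := one_pos.trans hR
  have hM0 : 0 ≤ M := (by positivity : 0 ≤ ‖(P 0).coeff 0‖ * R ^ 0).trans (hP 0 0)
  have hzero : ∀ {n k}, n < k → (P n).coeff k = 0 := fun h =>
    Polynomial.coeff_eq_zero_of_natDegree_lt ((hdeg _).trans_lt h)
  refine ⟨fun k => ∑' n, (P n).coeff k, ⟨M, fun k => ?_⟩, fun s hs => ?_⟩
  · rw [← le_div_iff₀ (by positivity)]
    refine IsUltrametricDist.norm_tsum_le_of_forall_le fun n => ?_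
    rcases lt_or_ge n k with h | h
    · rw [hzero h, norm_zero]; positivity
    · rw [le_div_iff₀ (by positivity)]
      refine le_trans ?_ (hP n k)
      gcongr
      exact hR.le
  · -- The double family is absolutely summable: with `r = max ‖s‖ 1 < R`, the row `n` has `n + 1`
    -- terms, each at most `M * (r / R) ^ n`.
    set r := max ‖s‖ 1 with hr
    have hrR : r < R := max_lt hs hR
    have hr0 : 0 < r := lt_of_lt_of_le one_pos (le_max_right _ _)
    have hbound : ∀ n k, ‖(P n).coeff k * s ^ k‖ ≤ if k ≤ n then M * (r / R) ^ n else 0 := by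
      intro n k
      split_ifs with h
      · have hsk : ‖s‖ ^ k ≤ r ^ n :=
          (pow_le_pow_left₀ (norm_nonneg _) (le_max_left _ _) k).trans
            (pow_le_pow_right₀ (le_max_right _ _) h)
        calc ‖(P n).coeff k * s ^ k‖ ≤ ‖(P n).coeff k‖ * r ^ n := by
              rw [norm_mul, norm_pow]; gcongr
          _ = (‖(P n).coeff k‖ * R ^ n) * (r / R) ^ n := by rw [div_pow]; field_simp
          _ ≤ _ := by gcongr; exact hP n k
      · rw [hzero (not_le.1 h)]; simp
    have hfam : Summable (fun x : ℕ × ℕ => (P x.1).coeff x.2 * s ^ x.2) := by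
      refine Summable.of_norm_bounded (g := fun x : ℕ × ℕ =>
        if x.2 ≤ x.1 then M * (r / R) ^ x.1 else 0) ?_ (fun x => hbound x.1 x.2)
      have hfin : ∀ n : ℕ, HasSum (fun k => if k ≤ n then M * (r / R) ^ n else 0)
          ((n + 1) * (M * (r / R) ^ n)) := by
        intro n
        have := hasSum_sum_of_ne_finset_zero (L := .unconditional ℕ) (s := Finset.range (n + 1))
          (f := fun k => if k ≤ n then M * (r / R) ^ n else 0)
          (fun k hk => if_neg (by simpa using hk))
        convert this using 1
        rw [Finset.sum_congr rfl fun k hk =>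
          if_pos (Nat.lt_succ_iff.1 (Finset.mem_range.1 hk))]
        simp
      refine (summable_prod_of_nonneg fun x => ?_).2 ⟨fun n => (hfin n).summable, ?_⟩
      · change (0 : ℝ) ≤ if _ then _ else _
        split_ifs <;> positivity
      · simp only [(hfin _).tsum_eq]
        have hq : ‖r / R‖ < 1 := by
          rw [Real.norm_of_nonneg (by positivity)]; exact (div_lt_one hR0).2 hrR
        have e1 := (summable_pow_mul_geometric_of_norm_lt_one 1 hq).mul_left M
        have e0 := (summable_pow_mul_geometric_of_norm_lt_one 0 hq).mul_left M
        refine (e1.add e0).congr fun n => ?_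
        ring
    have heval : ∀ n, (P n).eval s = ∑' k, (P n).coeff k * s ^ k := by
      intro n
      rw [Polynomial.eval_eq_sum_range' (Nat.lt_succ_of_le (hdeg n)),
        tsum_eq_sum (s := Finset.range (n + 1))]
      intro k hk
      rw [hzero (by simpa using hk), zero_mul]
    have hswap : Summable (fun x : ℕ × ℕ => (P x.2).coeff x.1 * s ^ x.1) := hfam.prod_symm
    have hmain : HasSum (fun k => ∑' n, (P n).coeff k * s ^ k)
        (∑' k, ∑' n, (P n).coeff k * s ^ k) := hswap.prod.hasSum
    simp only [heval]
    have hcomm : ∑' n, ∑' k, (P n).coeff k * s ^ k = ∑' k, ∑' n, (P n).coeff k * s ^ k :=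
      Summable.tsum_comm (f := fun k n => (P n).coeff k * s ^ k) hswap
    rw [hcomm]
    simpa only [tsum_mul_right] using hmain

end HasBoundedExpansion

/-- Identity theorem at `0` for power series converging near `0`. -/
theorem coeff_eq_zero_of_hasSum_zero {e : ℕ → K} {z : ℕ → K}
    (hsum : ∀ᶠ s in 𝓝 (0 : K), Summable (fun n => e n * s ^ n)) (hz : Tendsto z atTop (𝓝 0))
    (hz0 : ∀ k, z k ≠ 0) (hez : ∀ k, ∑' n, e n * z k ^ n = 0) : e = 0 := by
  set f : K → K := fun s => ∑' n, e n * s ^ n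
  have hps : HasFPowerSeriesAt f (FormalMultilinearSeries.ofScalars K e) 0 := by
    rw [hasFPowerSeriesAt_iff]
    filter_upwards [hsum] with s hs
    simpa [FormalMultilinearSeries.coeff_ofScalars, mul_comm] using hs.hasSum
  have hfreq : ∃ᶠ s in 𝓝[≠] (0 : K), f s = 0 := by
    have ht : Tendsto z atTop (𝓝[≠] 0) :=
      tendsto_nhdsWithin_iff.2 ⟨hz, Eventually.of_forall hz0⟩
    exact ht.frequently (Frequently.of_forall hez)
  have hev := (hps.analyticAt.frequently_zero_iff_eventually_zero).1 hfreq
  exact (FormalMultilinearSeries.ofScalars_series_eq_zero K).1 (hps.eq_zero_of_eventually hev)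

end BoundedExpansion

/-! ### Norms in `ℂ_[p]` -/

theorem norm_sub_le_max_norm {K : Type*} [SeminormedAddCommGroup K] [IsUltrametricDist K]
    (x y : K) : ‖x - y‖ ≤ max ‖x‖ ‖y‖ := by
  simpa [sub_eq_add_neg] using IsUltrametricDist.norm_add_le_max x (-y)

section PadicNorms

variable {p : ℕ} [Fact p.Prime]

theorem PadicComplex.norm_ratCast (x : ℚ) : ‖(x : ℂ_[p])‖ = ‖(x : ℚ_[p])‖ := by
  rw [← PadicComplex.norm_extends' p (x : ℚ_[p])]
  simp [PadicComplex.coe_eq]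

theorem PadicComplex.norm_natCast (n : ℕ) : ‖(n : ℂ_[p])‖ = ‖(n : ℚ_[p])‖ := by
  simpa using PadicComplex.norm_ratCast (p := p) (n : ℚ)

theorem PadicComplex.norm_p : ‖(p : ℂ_[p])‖ = (p : ℝ)⁻¹ := by
  rw [PadicComplex.norm_natCast, Padic.norm_p]

theorem PadicComplex.norm_natCast_eq_one {n : ℕ} (h : ¬ p ∣ n) : ‖(n : ℂ_[p])‖ = 1 := by
  rw [PadicComplex.norm_natCast, Padic.norm_natCast_eq_one_iff]
  exact (Fact.out : p.Prime).coprime_iff_not_dvd.2 h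

theorem PadicComplex.norm_natCast_le_of_dvd {m n : ℕ} (h : m ∣ n) :
    ‖(n : ℂ_[p])‖ ≤ ‖(m : ℂ_[p])‖ := by
  obtain ⟨k, rfl⟩ := h
  rw [Nat.cast_mul, norm_mul]
  exact mul_le_of_le_one_right (norm_nonneg _) (IsUltrametricDist.norm_natCast_le_one _ k)

theorem PadicComplex.norm_padicQ : ‖(padicQ p : ℂ_[p])‖ = (padicQ p : ℝ)⁻¹ := by
  by_cases h : p = 2
  · subst h
    have : ((padicQ 2 : ℕ) : ℂ_[2]) = ((2 : ℕ) : ℂ_[2]) ^ 2 := by norm_num [padicQ]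
    rw [this, norm_pow, PadicComplex.norm_p]
    norm_num [padicQ]
  · simp only [padicQ, if_neg h]
    exact PadicComplex.norm_p

theorem dvd_padicQ (p : ℕ) : p ∣ padicQ p := by
  unfold padicQ
  split_ifs with h
  · subst h; norm_num
  · exact dvd_rfl

theorem padicQ_pos : 0 < padicQ p := by
  have := (Fact.out : p.Prime).pos
  unfold padicQ
  split_ifs <;> omega

theorem dvd_padicQ_iff {l : ℕ} (hl : l.Prime) : l ∣ padicQ p ↔ l = p := by
  have hp : p.Prime := Fact.out
  refine ⟨fun h => ?_, fun h => h ▸ dvd_padicQ p⟩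
  unfold padicQ at h
  split_ifs at h with h2
  · subst h2
    exact (Nat.prime_dvd_prime_iff_eq hl Nat.prime_two).1
      (hl.dvd_of_dvd_pow (show l ∣ 2 ^ 2 by simpa using h))
  · exact (Nat.prime_dvd_prime_iff_eq hl hp).1 h

/-- The number `p ^ (1 / (p - 1))`, for which `padicLRadius p * factorialGrowth p = padicQ p` and
`‖(n + 1)!‖⁻¹ ≤ factorialGrowth p ^ n`. -/
noncomputable def factorialGrowth (p : ℕ) : ℝ := (p : ℝ) ^ (1 / ((p : ℝ) - 1))

theorem one_lt_cast_prime : (1 : ℝ) < p := by exact_mod_cast (Fact.out : p.Prime).one_lt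

theorem one_le_factorialGrowth : 1 ≤ factorialGrowth p := by
  have := one_lt_cast_prime (p := p)
  exact Real.one_le_rpow this.le (by rw [one_div_nonneg]; linarith)

theorem padicLRadius_mul_factorialGrowth :
    padicLRadius p * factorialGrowth p = padicQ p := by
  have := one_lt_cast_prime (p := p)
  rw [padicLRadius, factorialGrowth, mul_assoc, ← Real.rpow_add (by linarith), neg_div,
    neg_add_cancel, Real.rpow_zero, mul_one]

theorem factorialGrowth_lt_padicQ : factorialGrowth p < padicQ p := by
  have hp := one_lt_cast_prime (p := p)
  unfold factorialGrowth padicQ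
  split_ifs with h
  · subst h; norm_num
  · have hp3 : (3 : ℝ) ≤ p := by
      have := (Fact.out : p.Prime).two_le
      exact_mod_cast (show 3 ≤ p by omega)
    calc (p : ℝ) ^ (1 / ((p : ℝ) - 1)) < (p : ℝ) ^ (1 : ℝ) := by
          apply Real.rpow_lt_rpow_of_exponent_lt hp
          rw [div_lt_one (by linarith)]
          linarith
      _ = p := Real.rpow_one _

theorem one_lt_padicLRadius : 1 < padicLRadius p := by
  have h1 := one_le_factorialGrowth (p := p)
  have h2 := factorialGrowth_lt_padicQ (p := p)
  rw [← padicLRadius_mul_factorialGrowth] at h2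
  exact lt_of_mul_lt_mul_right (by simpa using h2) (by linarith)

theorem padicLRadius_pos : 0 < padicLRadius p := one_pos.trans one_lt_padicLRadius

theorem padicLRadius_le_padicQ : padicLRadius p ≤ padicQ p := by
  rw [← padicLRadius_mul_factorialGrowth]
  exact le_mul_of_one_le_right padicLRadius_pos.le one_le_factorialGrowth

theorem norm_factorial_succ_inv_le (n : ℕ) :
    ‖((n + 1).factorial : ℂ_[p])‖⁻¹ ≤ factorialGrowth p ^ n := by
  have hp := one_lt_cast_prime (p := p)
  have hlt := sub_one_mul_padicValNat_factorial_lt_of_ne_zero p (Nat.succ_ne_zero n)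
  have hle : ((p : ℝ) - 1) * padicValNat p (n + 1).factorial ≤ n := by
    have h : (p - 1) * padicValNat p (n + 1).factorial ≤ n := by
      simpa using Nat.lt_succ_iff.1 hlt
    have h' : (((p - 1 : ℕ) : ℝ)) * padicValNat p (n + 1).factorial ≤ n := by exact_mod_cast h
    rwa [Nat.cast_sub (Fact.out : p.Prime).one_lt.le, Nat.cast_one] at h'
  rw [PadicComplex.norm_natCast, Padic.norm_eq_zpow_neg_valuation
    (by exact_mod_cast Nat.factorial_ne_zero _), Padic.valuation_natCast, zpow_neg, inv_inv,
    zpow_natCast, factorialGrowth, ← Real.rpow_natCast, ← Real.rpow_mul_natCast (by linarith)]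
  apply Real.rpow_le_rpow_of_exponent_le hp.le
  rw [one_div, inv_mul_eq_div, le_div_iff₀ (by linarith)]
  linarith

theorem norm_factorial_inv_le (n : ℕ) :
    ‖(n.factorial : ℂ_[p])‖⁻¹ ≤ factorialGrowth p ^ n := by
  cases n with
  | zero => simp
  | succ n =>
    exact (norm_factorial_succ_inv_le n).trans
      (pow_le_pow_right₀ one_le_factorialGrowth n.le_succ)

/-- A weak form of the von Staudt–Clausen theorem. -/
theorem norm_bernoulli_le (n : ℕ) : ‖((bernoulli n : ℚ) : ℂ_[p])‖ ≤ p := by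
  have hp := one_lt_cast_prime (p := p)
  rw [PadicComplex.norm_ratCast]
  have hinv : ∀ l : ℕ, l.Prime → ‖((1 / (l : ℚ) : ℚ) : ℚ_[p])‖ ≤ p := by
    intro l hl
    push_cast
    rw [norm_div, norm_one]
    by_cases h : l = p
    · subst h; rw [Padic.norm_p]; simp
    · rw [Padic.norm_natCast_eq_one_iff.2
        ((Nat.coprime_primes (Fact.out : p.Prime) hl).2 (Ne.symm h))]
      linarith
  rcases Nat.even_or_odd' n with ⟨k, rfl | rfl⟩
  · obtain ⟨z, hz⟩ := Bernoulli.vonStaudt_clausen k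
    rw [eq_sub_of_add_eq hz.symm]
    push_cast
    refine (norm_sub_le_max_norm _ _).trans (max_le ?_ ?_)
    · exact (Padic.norm_int_le_one z).trans hp.le
    · refine IsUltrametricDist.norm_sum_le_of_forall_le_of_nonneg (by positivity) fun l hl => ?_
      simpa using hinv l (Finset.mem_filter.1 hl).2.1
  · rcases Nat.eq_zero_or_pos k with rfl | hk
    · have := hinv 2 Nat.prime_two
      simpa [bernoulli_one, norm_div] using this
    · rw [bernoulli_eq_zero_of_odd ⟨k, rfl⟩ (by omega)]
      simp

end PadicNorms

/-! ### Binomial series -/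

section BinomialSeries

variable {p : ℕ} [Fact p.Prime] {M : ℝ}

/-- The factor `‖s‖` keeps the bound usable after division by `s`. -/
theorem norm_padicBinom_succ_le {s : ℂ_[p]} {r : ℝ} (hr : 1 ≤ r) (hs : ‖s‖ ≤ r) (n : ℕ) :
    ‖padicBinom s (n + 1)‖ ≤ ‖s‖ * (r * factorialGrowth p) ^ n := by
  rw [padicBinom, Finset.prod_range_succ', norm_div, norm_mul, Nat.cast_zero, sub_zero,
    div_eq_mul_inv, mul_pow, mul_comm _ ‖s‖, mul_assoc]
  gcongr
  · rw [norm_prod]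
    calc ∏ i ∈ Finset.range n, ‖s - ((i + 1 : ℕ) : ℂ_[p])‖ ≤ ∏ _i ∈ Finset.range n, r := by
          refine Finset.prod_le_prod (fun _ _ => norm_nonneg _) fun i _ => ?_
          exact (norm_sub_le_max_norm _ _).trans
            (max_le hs ((IsUltrametricDist.norm_natCast_le_one _ _).trans hr))
      _ = r ^ n := by simp
  · exact norm_factorial_succ_inv_le n

theorem norm_padicBinom_succ_le_padicQ_pow {s : ℂ_[p]} (hs : ‖s‖ ≤ padicLRadius p) (n : ℕ) :
    ‖padicBinom s (n + 1)‖ ≤ ‖s‖ * (padicQ p : ℝ) ^ n := by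
  simpa [padicLRadius_mul_factorialGrowth] using
    norm_padicBinom_succ_le one_lt_padicLRadius.le hs n

theorem summable_padicBinom_mul {v : ℕ → ℂ_[p]} (hv : ∀ n, ‖v n‖ * (padicQ p : ℝ) ^ n ≤ M)
    {s : ℂ_[p]} (hs : ‖s‖ < padicLRadius p) : Summable (fun n => padicBinom s n * v n) := by
  have hR := padicLRadius_pos (p := p)
  set r := max ‖s‖ 1 with hrdef
  have hr1 : 1 ≤ r := le_max_right _ _
  have hrR : r < padicLRadius p := max_lt hs one_lt_padicLRadius
  have hg := one_le_factorialGrowth (p := p)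
  have hbin : ∀ n, ‖padicBinom s n‖ ≤ (r * factorialGrowth p) ^ n := by
    rintro (_ | n)
    · simp [padicBinom]
    · refine (norm_padicBinom_succ_le hr1 (le_max_left _ _) n).trans ?_
      rw [pow_succ']
      gcongr
      calc ‖s‖ ≤ r * 1 := by rw [mul_one]; exact le_max_left _ _
        _ ≤ _ := by gcongr
  refine Summable.of_norm_bounded (g := fun n => M * (r / padicLRadius p) ^ n)
    ((summable_geometric_of_lt_one (by positivity) ((div_lt_one hR).2 hrR)).mul_left M)
    fun n => ?_
  calc ‖padicBinom s n * v n‖ ≤ (r * factorialGrowth p) ^ n * ‖v n‖ := by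
        rw [norm_mul]; gcongr; exact hbin n
    _ = ‖v n‖ * (padicQ p : ℝ) ^ n * (r / padicLRadius p) ^ n := by
        rw [← padicLRadius_mul_factorialGrowth, mul_pow, mul_pow, div_pow]
        field_simp
    _ ≤ _ := by gcongr; exact hv n

/-- The polynomial `n! * (1 - s choose n)` in `s` has integer coefficients, so the coefficients of
`(1 - s choose n) * v n` are at most `‖v n‖ / ‖n!‖`, which is `O(R ^ (-n))` by Legendre's formula. -/
theorem HasBoundedExpansion.tsum_padicBinom_one_sub_mul {v : ℕ → ℂ_[p]}
    (hv : ∀ n, ‖v n‖ * (padicQ p : ℝ) ^ n ≤ M) :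
    HasBoundedExpansion (padicLRadius p)
      (fun s : ℂ_[p] => ∑' n, padicBinom (1 - s) n * v n) := by
  have hR := padicLRadius_pos (p := p)
  let Q : ℕ → Polynomial ℤ := fun n =>
    ∏ i ∈ Finset.range n, (Polynomial.C (1 - (i : ℤ)) - Polynomial.X)
  let P : ℕ → Polynomial ℂ_[p] := fun n =>
    Polynomial.C (v n / (n.factorial : ℂ_[p])) * (Q n).map (Int.castRingHom ℂ_[p])
  have hQdeg : ∀ n, (Q n).natDegree ≤ n := by
    intro n
    refine (Polynomial.natDegree_prod_le _ _).trans ?_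
    refine (Finset.sum_le_card_nsmul _ _ 1 fun i _ => ?_).trans (by simp)
    exact (Polynomial.natDegree_sub_le _ _).trans
      (max_le (by rw [Polynomial.natDegree_C]; exact zero_le_one) Polynomial.natDegree_X_le)
  have hdeg : ∀ n, (P n).natDegree ≤ n := fun n =>
    (Polynomial.natDegree_C_mul_le _ _).trans (Polynomial.natDegree_map_le.trans (hQdeg n))
  have hP : ∀ n k, ‖(P n).coeff k‖ * padicLRadius p ^ n ≤ M := by
    intro n k
    refine le_trans ?_ (hv n)
    have hz : ‖(((Q n).coeff k : ℤ) : ℂ_[p])‖ ≤ 1 := IsUltrametricDist.norm_intCast_le_one _ _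
    have hf := norm_factorial_inv_le (p := p) n
    simp only [P, Polynomial.coeff_C_mul, Polynomial.coeff_map, eq_intCast, norm_mul, norm_div]
    calc ‖v n‖ / ‖(n.factorial : ℂ_[p])‖ * ‖(((Q n).coeff k : ℤ) : ℂ_[p])‖ * padicLRadius p ^ n
        ≤ ‖v n‖ * factorialGrowth p ^ n * 1 * padicLRadius p ^ n := by
          have hg := one_le_factorialGrowth (p := p)
          rw [div_eq_mul_inv]; gcongr
      _ = ‖v n‖ * (padicQ p : ℝ) ^ n := by
          rw [← padicLRadius_mul_factorialGrowth]; ring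
  refine (HasBoundedExpansion.of_polynomials one_lt_padicLRadius hdeg hP).congr fun s _ => ?_
  refine tsum_congr fun n => ?_
  simp only [P, Q, Polynomial.map_prod, Polynomial.eval_mul, Polynomial.eval_C,
    Polynomial.eval_prod, padicBinom]
  rw [div_mul_eq_mul_div, div_mul_eq_mul_div, mul_comm]
  congr 2
  refine Finset.prod_congr rfl fun i _ => ?_
  simp
  ring

theorem padicBinom_natCast (n k : ℕ) : padicBinom (n : ℂ_[p]) k = n.choose k := by
  rw [padicBinom, div_eq_iff (by exact_mod_cast Nat.factorial_ne_zero k)]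
  have : (n.choose k * k.factorial : ℕ) = n.descFactorial k := by
    rw [Nat.descFactorial_eq_factorial_mul_choose, mul_comm]
  rw [← Nat.cast_mul, this, ← descPochhammer_eval_eq_descFactorial,
    descPochhammer_eval_eq_prod_range]

theorem tsum_padicBinom_natCast_mul (n : ℕ) (v : ℕ → ℂ_[p]) :
    ∑' k, padicBinom (n : ℂ_[p]) k * v k =
      ∑ k ∈ Finset.range (n + 1), (n.choose k : ℂ_[p]) * v k := by
  rw [tsum_eq_sum (s := Finset.range (n + 1))]
  · simp only [padicBinom_natCast]
  · intro k hk
    rw [padicBinom_natCast, Nat.choose_eq_zero_of_lt (by simpa using hk)]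
    simp

theorem padicPow_natCast (x : ℂ_[p]) (n : ℕ) : padicPow x (n : ℂ_[p]) = x ^ n := by
  rw [padicPow, tsum_padicBinom_natCast_mul]
  conv_rhs => rw [← sub_add_cancel x 1, add_pow]
  refine Finset.sum_congr rfl fun k _ => ?_
  rw [one_pow]; ring

theorem norm_sub_one_pow_mul_le {x : ℂ_[p]} (hx : ‖x - 1‖ ≤ (padicQ p : ℝ)⁻¹) (n : ℕ) :
    ‖(x - 1) ^ n‖ * (padicQ p : ℝ) ^ n ≤ 1 := by
  have hq : (0 : ℝ) < padicQ p := by exact_mod_cast padicQ_pos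
  rw [norm_pow, ← mul_pow]
  exact pow_le_one₀ (by positivity) ((le_div_iff₀ hq).1 (by simpa using hx))

theorem norm_padicPow_le_one {x s : ℂ_[p]} (hx : ‖x - 1‖ ≤ (padicQ p : ℝ)⁻¹)
    (hs : ‖s‖ ≤ padicLRadius p) : ‖padicPow x s‖ ≤ 1 := by
  have hq : (0 : ℝ) < padicQ p := by exact_mod_cast padicQ_pos
  refine IsUltrametricDist.norm_tsum_le_of_forall_le fun n => ?_
  rcases n with _ | n
  · simp [padicBinom]
  · have h1 := norm_padicBinom_succ_le_padicQ_pow hs n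
    have h2 := norm_sub_one_pow_mul_le hx (n + 1)
    rw [norm_mul]
    calc ‖padicBinom s (n + 1)‖ * ‖(x - 1) ^ (n + 1)‖
        ≤ (padicQ p * (padicQ p : ℝ) ^ n) * ‖(x - 1) ^ (n + 1)‖ := by
          gcongr
          refine h1.trans ?_
          gcongr
          exact hs.trans padicLRadius_le_padicQ
      _ ≤ 1 := by rw [← pow_succ', mul_comm]; exact h2

theorem norm_pow_succ_sub_pow_succ_le {K : Type*} [NormedField K] [IsUltrametricDist K]
    {u v : K} {t : ℝ} (hu : ‖u‖ ≤ t) (hv : ‖v‖ ≤ t) (n : ℕ) :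
    ‖u ^ (n + 1) - v ^ (n + 1)‖ ≤ ‖u - v‖ * t ^ n := by
  have ht : 0 ≤ t := (norm_nonneg _).trans hu
  rw [← (Commute.all u v).geom_sum₂_mul (n + 1), norm_mul, mul_comm]
  gcongr
  refine IsUltrametricDist.norm_sum_le_of_forall_le_of_nonneg (by positivity) fun i hi => ?_
  have hi' : i + (n + 1 - 1 - i) = n := by have := Finset.mem_range.1 hi; omega
  rw [norm_mul, norm_pow, norm_pow]
  calc ‖u‖ ^ i * ‖v‖ ^ (n + 1 - 1 - i) ≤ t ^ i * t ^ (n + 1 - 1 - i) := by gcongr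
    _ = t ^ n := by rw [← pow_add, hi']

/-- Lipschitz dependence on the base, read off from the series termwise. It compares `⟨a⟩ ^ t` with
`⟨F - a⟩ ^ t` without any multiplicativity of `padicPow`. -/
theorem norm_padicPow_sub_padicPow_le {x y s : ℂ_[p]} (hx : ‖x - 1‖ ≤ (padicQ p : ℝ)⁻¹)
    (hy : ‖y - 1‖ ≤ (padicQ p : ℝ)⁻¹) (hs : ‖s‖ < padicLRadius p) :
    ‖padicPow x s - padicPow y s‖ ≤ padicLRadius p * ‖x - y‖ := by
  have hq : (0 : ℝ) < padicQ p := by exact_mod_cast padicQ_pos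
  have hR := padicLRadius_pos (p := p)
  rw [padicPow, padicPow,
    ← (summable_padicBinom_mul (norm_sub_one_pow_mul_le hx) hs).tsum_sub
      (summable_padicBinom_mul (norm_sub_one_pow_mul_le hy) hs)]
  refine IsUltrametricDist.norm_tsum_le_of_forall_le fun n => ?_
  rw [← mul_sub]
  rcases n with _ | n
  · simp; positivity
  · have h1 := norm_padicBinom_succ_le_padicQ_pow hs.le n
    have h2 := norm_pow_succ_sub_pow_succ_le hx hy n
    rw [sub_sub_sub_cancel_right] at h2
    rw [norm_mul]
    calc _ ≤ (padicLRadius p * (padicQ p : ℝ) ^ n) * (‖x - y‖ * (padicQ p : ℝ)⁻¹ ^ n) := by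
          gcongr
          refine h1.trans ?_
          gcongr
      _ = padicLRadius p * ‖x - y‖ := by
          rw [inv_pow]; field_simp

end BinomialSeries

/-! ### The Teichmüller character and its twists -/

section Characters

variable {p : ℕ} [Fact p.Prime]

instance neZero_padicQ : NeZero (padicQ p) := ⟨padicQ_pos.ne'⟩

theorem norm_teichmullerCharacter_sub_le {a : ℕ} (ha : ¬ p ∣ a) :
    ‖teichmullerCharacter p a - a‖ ≤ (padicQ p : ℝ)⁻¹ := by
  obtain ⟨y, hy⟩ := (exists_teichmullerCharacter p).choose_spec a ha
  set φ : ℤ_[p] →+* ℂ_[p] := (algebraMap ℚ_[p] ℂ_[p]).comp PadicInt.Coe.ringHom with hφ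
  have h := congrArg φ hy
  rw [map_sub, map_mul, map_natCast φ, map_natCast φ] at h
  rw [teichmullerCharacter, MulChar.ringHomComp_apply, ← hφ, h, norm_mul, PadicComplex.norm_padicQ]
  refine mul_le_of_le_one_right (by positivity) ?_
  exact (PadicComplex.norm_extends' p _).le.trans (PadicInt.norm_le_one y)

theorem padicQ_inv_lt_one : (padicQ p : ℝ)⁻¹ < 1 := by
  have h : (1 : ℝ) < padicQ p := one_lt_padicLRadius.trans_le padicLRadius_le_padicQ
  exact inv_lt_one_of_one_lt₀ h

theorem natCast_coprime_padicQ {a : ℕ} (ha : ¬ p ∣ a) : a.Coprime (padicQ p) := by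
  refine Nat.coprime_of_dvd fun l hl hla hlq => ?_
  rw [dvd_padicQ_iff hl] at hlq
  exact ha (hlq ▸ hla)

theorem norm_teichmullerCharacter {a : ℕ} (ha : ¬ p ∣ a) :
    ‖teichmullerCharacter p a‖ = 1 := by
  refine DirichletCharacter.unit_norm_eq_one _
    ((ZMod.isUnit_iff_coprime a (padicQ p)).2 (natCast_coprime_padicQ ha)).unit

theorem teichmullerCharacter_neg_one : teichmullerCharacter p (-1) = -1 := by
  have hsq : teichmullerCharacter p (-1) * teichmullerCharacter p (-1) = 1 := by
    rw [← map_mul]; simp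
  rcases mul_self_eq_one_iff.1 hsq with h | h
  swap
  · exact h
  exfalso
  have hq := padicQ_pos (p := p)
  have hpq := dvd_padicQ p
  have hnd : ¬ p ∣ padicQ p - 1 := fun hd => by
    have := (Nat.dvd_sub hpq hd)
    rw [Nat.sub_sub_self hq] at this
    exact (Fact.out : p.Prime).one_lt.ne' (Nat.dvd_one.1 this)
  have hle := norm_teichmullerCharacter_sub_le hnd
  rw [Nat.cast_sub hq, Nat.cast_sub hq] at hle
  simp only [CharP.cast_eq_zero, Nat.cast_one, zero_sub, h] at hle
  -- `2 = (1 - (q - 1)) + q` would be divisible by `q`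
  have h2 : ‖((2 : ℕ) : ℂ_[p])‖ ≤ (padicQ p : ℝ)⁻¹ := by
    have : ((2 : ℕ) : ℂ_[p]) = (1 - ((padicQ p : ℂ_[p]) - 1)) + (padicQ p : ℂ_[p]) := by
      push_cast; ring
    rw [this]
    exact (IsUltrametricDist.norm_add_le_max _ _).trans
      (max_le hle PadicComplex.norm_padicQ.le)
  by_cases hp2 : p = 2
  · subst hp2
    rw [PadicComplex.norm_p] at h2
    norm_num [padicQ] at h2
  · rw [PadicComplex.norm_natCast_eq_one
      (fun hd => hp2 ((Nat.prime_dvd_prime_iff_eq Fact.out Nat.prime_two).1 hd))] at h2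
    exact absurd h2 (not_le.2 padicQ_inv_lt_one)

theorem norm_angle_sub_one_le {a : ℕ} (ha : ¬ p ∣ a) :
    ‖angle p a - 1‖ ≤ (padicQ p : ℝ)⁻¹ := by
  have h1 := norm_teichmullerCharacter ha
  have h0 : teichmullerCharacter p a ≠ 0 := norm_ne_zero_iff.1 (by rw [h1]; exact one_ne_zero)
  rw [angle, div_sub_one h0, norm_div, h1, div_one, norm_sub_rev]
  exact norm_teichmullerCharacter_sub_le ha

theorem DirichletCharacter.mul_apply_of_coprime {R : Type*} [CommRing R] {f m : ℕ}
    (χ : DirichletCharacter R f) (θ : DirichletCharacter R m) {a : ℕ}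
    (ha : a.Coprime (f.lcm m)) : χ.mul θ a = χ a * θ a := by
  have h : IsCoprime (a : ℤ) (f.lcm m : ℕ) := Nat.isCoprime_iff_coprime.2 ha
  have e1 := DirichletCharacter.changeLevel_eq_cast_of_dvd' χ (Nat.dvd_lcm_left f m) h
  have e2 := DirichletCharacter.changeLevel_eq_cast_of_dvd' θ (Nat.dvd_lcm_right f m) h
  simp only [Int.cast_natCast] at e1 e2
  rw [DirichletCharacter.mul, MulChar.mul_apply, e1, e2]

/-- Multiplying a primitive character by a character modulo `m` changes its conductor only at
the primes dividing `m`. -/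
theorem DirichletCharacter.IsPrimitive.dvd_lcm_conductor_mul {R : Type*} [CommRing R] {f m : ℕ}
    [NeZero f] [NeZero m] {χ : DirichletCharacter R f} (hχ : χ.IsPrimitive)
    (θ : DirichletCharacter R m) : f ∣ (χ.mul θ).conductor.lcm m := by
  have : NeZero (f.lcm m) := ⟨Nat.lcm_ne_zero (NeZero.ne f) (NeZero.ne m)⟩
  have h := DirichletCharacter.conductor_mul_dvd_lcm_conductor (χ.mul θ)
    (DirichletCharacter.changeLevel (Nat.dvd_lcm_right f m) θ)⁻¹
  have e : χ.mul θ * (DirichletCharacter.changeLevel (Nat.dvd_lcm_right f m) θ)⁻¹ =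
      DirichletCharacter.changeLevel (Nat.dvd_lcm_left f m) χ := by
    rw [DirichletCharacter.mul, mul_inv_cancel_right]
  rw [e, DirichletCharacter.conductor_changeLevel, DirichletCharacter.conductor_inv,
    DirichletCharacter.conductor_changeLevel, (DirichletCharacter.isPrimitive_def χ).1 hχ] at h
  exact h.trans (Nat.lcm_dvd (Nat.dvd_lcm_left _ _)
    (θ.conductor_dvd_level.trans (Nat.dvd_lcm_right _ _)))

variable {f : ℕ} [NeZero f] {χ : DirichletCharacter ℂ_[p] f}

theorem natCast_apply_eq_zero_of_dvd {R : Type*} [CommRing R] {m l a : ℕ}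
    (θ : DirichletCharacter R m) (hl : l.Prime) (hlm : l ∣ m) (hla : l ∣ a) : θ a = 0 := by
  refine MulChar.map_nonunit _ fun hu => ?_
  rw [ZMod.isUnit_iff_coprime] at hu
  exact Nat.not_coprime_of_dvd_of_dvd hl.one_lt hla hlm hu

/-- Away from the multiples of `p`, the primitive character attached to `χ ω⁻ⁿ` is the product of
the values. At a prime `l ≠ p` dividing `f` both sides vanish, since `l` still divides the conductor
of the twist. -/
theorem teichmullerTwist_apply (hχ : χ.IsPrimitive) (n : ℕ) {a : ℕ} (ha : ¬ p ∣ a) :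
    teichmullerTwist χ n a = χ a / teichmullerCharacter p a ^ n := by
  have hinv : ((teichmullerCharacter p ^ n)⁻¹ : DirichletCharacter ℂ_[p] (padicQ p)) a =
      (teichmullerCharacter p a ^ n)⁻¹ := by
    obtain ⟨u, hu⟩ := (ZMod.isUnit_iff_coprime a (padicQ p)).2 (natCast_coprime_padicQ ha)
    rw [MulChar.inv_apply_eq_inv', ← hu, MulChar.pow_apply_coe]
  by_cases hc : a.Coprime (f.lcm (padicQ p))
  · have h := DirichletCharacter.primitiveCharacter_apply_of_isCoprime
      (χ.mul (teichmullerCharacter p ^ n)⁻¹) (Nat.isCoprime_iff_coprime.2 hc)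
    simp only [Int.cast_natCast] at h
    rw [teichmullerTwist, DirichletCharacter.mul_def, h,
      DirichletCharacter.mul_apply_of_coprime _ _ hc, hinv, div_eq_mul_inv]
  · obtain ⟨l, hl, hla, hlN⟩ := Nat.Prime.not_coprime_iff_dvd.1 hc
    have hlq : ¬ l ∣ padicQ p := fun h => ha ((dvd_padicQ_iff hl).1 h ▸ hla)
    have hlf : l ∣ f := by
      rcases (Nat.Prime.dvd_lcm hl).1 hlN with h | h
      · exact h
      · exact absurd h hlq
    have hlm : l ∣ (χ.mul (teichmullerCharacter p ^ n)⁻¹).conductor := by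
      rcases (Nat.Prime.dvd_lcm hl).1 (hlf.trans (hχ.dvd_lcm_conductor_mul
          (teichmullerCharacter p ^ n)⁻¹)) with h | h
      · exact h
      · exact absurd h hlq
    rw [natCast_apply_eq_zero_of_dvd _ hl hlm hla, natCast_apply_eq_zero_of_dvd _ hl hlf hla,
      zero_div]

end Characters

/-! ### Generalized Bernoulli numbers -/

section GeneralizedBernoulli

theorem sum_Icc_one_mul {M : Type*} [AddCommMonoid M] (g : ℕ → M) (m k : ℕ) :
    ∑ a ∈ Finset.Icc 1 (m * k), g a =
      ∑ b ∈ Finset.Icc 1 m, ∑ i ∈ Finset.range k, g (b + m * i) := by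
  rw [Finset.sum_comm]
  induction k with
  | zero => simp
  | succ k ih =>
    rw [Finset.sum_range_succ, ← ih, Nat.mul_succ, ← Finset.sum_image (s := Finset.Icc 1 m)
      (g := fun b => b + m * k) (f := g) (fun _ _ _ _ h => by simpa using h), ← Finset.sum_union]
    · congr 1
      ext a
      simp only [Finset.mem_union, Finset.mem_Icc, Finset.mem_image]
      constructor
      · rintro ⟨h1, h2⟩
        by_cases h : a ≤ m * k
        · exact Or.inl ⟨h1, h⟩
        · exact Or.inr ⟨a - m * k, by omega, by omega⟩
      · rintro (⟨h1, h2⟩ | ⟨b, ⟨h1, h2⟩, rfl⟩) <;> exact ⟨by omega, by omega⟩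
    · rw [Finset.disjoint_left]
      rintro a ha hb
      obtain ⟨b, hb', rfl⟩ := Finset.mem_image.1 hb
      have h1 := (Finset.mem_Icc.1 ha).2
      have h2 := (Finset.mem_Icc.1 hb').1
      beta_reduce at h1
      omega

theorem sum_Icc_one_filter_not_dvd {M : Type*} [AddCommGroup M] (g : ℕ → M) {p : ℕ} (hp : 0 < p)
    (k : ℕ) :
    ∑ a ∈ (Finset.Icc 1 (p * k)).filter (fun a => ¬ p ∣ a), g a =
      ∑ a ∈ Finset.Icc 1 (p * k), g a - ∑ b ∈ Finset.Icc 1 k, g (p * b) := by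
  rw [eq_sub_iff_add_eq', ← Finset.sum_filter_add_sum_filter_not (Finset.Icc 1 (p * k))
    (fun a => p ∣ a)]
  congr 1
  rw [← Finset.sum_image (s := Finset.Icc 1 k) (g := fun b => p * b) (f := g)
    (fun _ _ _ _ h => Nat.eq_of_mul_eq_mul_left hp h)]
  congr 1
  ext a
  simp only [Finset.mem_filter, Finset.mem_Icc, Finset.mem_image]
  constructor
  · rintro ⟨b, ⟨h1, h2⟩, rfl⟩
    exact ⟨⟨Nat.mul_pos hp h1, Nat.mul_le_mul_left p h2⟩, dvd_mul_right _ _⟩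
  · rintro ⟨⟨h1, h2⟩, b, rfl⟩
    exact ⟨b, ⟨Nat.pos_of_mul_pos_left h1, Nat.le_of_mul_le_mul_left h2 hp⟩, rfl⟩

theorem Polynomial.bernoulli_eval_mul (n : ℕ) {k : ℕ} (hk : k ≠ 0) (x : ℚ) :
    (Polynomial.bernoulli n).eval (k * x) =
      (k : ℚ) ^ n / k * ∑ i ∈ Finset.range k, (Polynomial.bernoulli n).eval (x + i / k) := by
  have hcast : ∀ y : ℚ, bernoulliFun n (y : ℝ) = (((Polynomial.bernoulli n).eval y : ℚ) : ℝ) := by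
    intro y
    rw [bernoulliFun, ← eq_ratCast (algebraMap ℚ ℝ), Polynomial.eval_map_apply, eq_ratCast]
  have h := bernoulliFun_mul n hk (x : ℝ)
  have e : ∀ i : ℕ, (x : ℝ) + i / k = ((x + i / k : ℚ) : ℝ) := fun i => by push_cast; rfl
  have e' : (k : ℝ) * x = ((k * x : ℚ) : ℝ) := by push_cast; rfl
  simp only [e, e', hcast] at h
  rw [← Rat.cast_inj (α := ℝ), h]
  push_cast
  rfl

theorem natCast_pow_mul_bernoulli_eval (k : ℕ) {F : ℕ} (hF : F ≠ 0) (a : ℕ) :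
    (F : ℚ) ^ k * (Polynomial.bernoulli (k + 1)).eval ((a : ℚ) / F) =
      1 / F * ∑ j ∈ Finset.range (k + 1 + 1),
        ((k + 1).choose j : ℚ) * (bernoulli j * F ^ j * a ^ (k + 1 - j)) := by
  have hF' : (F : ℚ) ≠ 0 := by exact_mod_cast hF
  rw [Polynomial.bernoulli, Polynomial.eval_finsetSum, Finset.mul_sum, Finset.mul_sum]
  refine Finset.sum_congr rfl fun j hj => ?_
  have hj' : j ≤ k + 1 := Nat.lt_succ_iff.1 (Finset.mem_range.1 hj)
  rw [Polynomial.eval_monomial, div_pow]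
  have : (F : ℚ) ^ k * F = F ^ j * F ^ (k + 1 - j) := by
    rw [← pow_succ, ← pow_add, Nat.add_sub_cancel' hj']
  field_simp
  linear_combination (bernoulli j * ((k + 1).choose j : ℚ) * a ^ (k + 1 - j)) * this

theorem DirichletCharacter.sum_Icc_eq_zero {R : Type*} [CommRing R] [IsDomain R] {m : ℕ}
    [NeZero m] {θ : DirichletCharacter R m} (hθ : θ ≠ 1) {N : ℕ} (hN : m ∣ N) :
    ∑ a ∈ Finset.Icc 1 N, θ a = 0 := by
  obtain ⟨k, rfl⟩ := hN
  have hm := NeZero.pos m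
  have hone : ∑ a ∈ Finset.Icc 1 m, θ a = 0 := by
    rw [← MulChar.sum_eq_zero_of_ne_one hθ]
    refine Finset.sum_bij (fun a _ => (a : ZMod m)) (fun _ _ => Finset.mem_univ _) ?_ ?_
      (fun _ _ => rfl)
    · intro a ha b hb hab
      rw [Finset.mem_Icc] at ha hb
      have h := (ZMod.natCast_eq_natCast_iff _ _ _).1 hab
      rcases le_total a b with hle | hle
      · have hd := (Nat.modEq_iff_dvd' hle).1 h
        have := Nat.eq_zero_of_dvd_of_lt hd (by omega)
        omega
      · have hd := (Nat.modEq_iff_dvd' hle).1 h.symm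
        have := Nat.eq_zero_of_dvd_of_lt hd (by omega)
        omega
    · intro x _
      by_cases hx : x.val = 0
      · refine ⟨m, Finset.mem_Icc.2 ⟨hm, le_rfl⟩, ?_⟩
        rw [ZMod.natCast_self, (ZMod.val_eq_zero x).1 hx]
      · exact ⟨x.val, Finset.mem_Icc.2 ⟨by omega, (ZMod.val_lt x).le⟩, ZMod.natCast_zmod_val x⟩
  rw [sum_Icc_one_mul]
  simp [Finset.sum_const, ← Finset.mul_sum, hone]

variable {p : ℕ} [Fact p.Prime] {m : ℕ}

theorem generalizedBernoulli_succ (k : ℕ) (ψ : DirichletCharacter ℂ_[p] m) :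
    generalizedBernoulli (k + 1) ψ = (m : ℂ_[p]) ^ k * ∑ a ∈ Finset.Icc 1 m,
      ψ a * (((Polynomial.bernoulli (k + 1)).eval ((a : ℚ) / m) : ℚ) : ℂ_[p]) := by
  rw [generalizedBernoulli, Nat.cast_succ, add_sub_cancel_right, zpow_natCast]

/-- The defining formula holds with any multiple of the modulus in place of the modulus. -/
theorem generalizedBernoulli_succ_eq_of_dvd [NeZero m] (k : ℕ) (ψ : DirichletCharacter ℂ_[p] m)
    {F : ℕ} (hF : F ≠ 0) (hm : m ∣ F) :
    generalizedBernoulli (k + 1) ψ = (F : ℂ_[p]) ^ k * ∑ a ∈ Finset.Icc 1 F,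
      ψ a * (((Polynomial.bernoulli (k + 1)).eval ((a : ℚ) / F) : ℚ) : ℂ_[p]) := by
  obtain ⟨d, rfl⟩ := hm
  have hd : d ≠ 0 := right_ne_zero_of_mul hF
  have hd' : (d : ℚ) ≠ 0 := by exact_mod_cast hd
  have hm' : (m : ℚ) ≠ 0 := by exact_mod_cast NeZero.ne m
  rw [generalizedBernoulli_succ, sum_Icc_one_mul, Finset.mul_sum, Finset.mul_sum]
  refine Finset.sum_congr rfl fun b _ => ?_
  have hb := Polynomial.bernoulli_eval_mul (k + 1) hd ((b : ℚ) / (m * d))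
  rw [show (d : ℚ) * (b / (m * d)) = b / m by field_simp, pow_succ, mul_div_cancel_right₀ _ hd']
    at hb
  rw [hb]
  push_cast
  rw [mul_pow, Finset.mul_sum, Finset.mul_sum, Finset.mul_sum, Finset.mul_sum]
  refine Finset.sum_congr rfl fun i _ => ?_
  rw [show (b : ℚ) / (m * d) + i / d = (b + m * i) / (m * d) by field_simp]
  simp
  ring

/-- Removing the multiples of `p` from the sum produces the Euler factor at `p`. -/
theorem sum_filter_not_dvd_bernoulli [NeZero m] (k : ℕ) (ψ : DirichletCharacter ℂ_[p] m)
    {F : ℕ} (hF : F ≠ 0) (hm : m ∣ F) (hp : p ∣ F) :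
    (F : ℂ_[p]) ^ k * ∑ a ∈ (Finset.Icc 1 F).filter (fun a => ¬ p ∣ a),
      ψ a * (((Polynomial.bernoulli (k + 1)).eval ((a : ℚ) / F) : ℚ) : ℂ_[p]) =
    (1 - ψ p * (p : ℂ_[p]) ^ k) * generalizedBernoulli (k + 1) ψ := by
  have hp0 : 0 < p := (Fact.out : p.Prime).pos
  have hp' : (p : ℚ) ≠ 0 := by exact_mod_cast hp0.ne'
  have h1 := generalizedBernoulli_succ_eq_of_dvd k ψ hF hm
  obtain ⟨d, rfl⟩ := hp
  have hd : d ≠ 0 := right_ne_zero_of_mul hF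
  rw [sum_Icc_one_filter_not_dvd _ hp0, mul_sub, ← h1, sub_mul, one_mul]
  congr 1
  by_cases hpm : p ∣ m
  · have h0 : ψ p = 0 := natCast_apply_eq_zero_of_dvd ψ Fact.out hpm dvd_rfl
    simp [h0]
  · have hmd : m ∣ d :=
      (Nat.Coprime.symm ((Fact.out : p.Prime).coprime_iff_not_dvd.2 hpm)).dvd_of_dvd_mul_left hm
    rw [generalizedBernoulli_succ_eq_of_dvd k ψ hd hmd]
    push_cast
    rw [mul_pow, Finset.mul_sum, Finset.mul_sum, Finset.mul_sum]
    refine Finset.sum_congr rfl fun b _ => ?_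
    rw [map_mul, mul_div_mul_left _ _ hp']
    ring

end GeneralizedBernoulli

/-! ### The numerator of the `p`-adic `L`-function -/

section Numerator

variable {p : ℕ} [Fact p.Prime] {f : ℕ}

/-- The series `∑ⱼ (1 - s choose j) Bⱼ (F / a) ^ j`, with `B₁ = -1 / 2`. -/
noncomputable def bernoulliSeries (p : ℕ) [Fact p.Prime] (F a : ℕ) (s : ℂ_[p]) : ℂ_[p] :=
  ∑' j, padicBinom (1 - s) j * (((bernoulli j : ℚ) : ℂ_[p]) * ((F : ℂ_[p]) / (a : ℂ_[p])) ^ j)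

/-- The function `(s - 1) L_p(s, χ)`, written with the help of a common multiple `F` of `q` and the
conductor of `χ`. -/
noncomputable def padicLNumerator (χ : DirichletCharacter ℂ_[p] f) (F : ℕ) (s : ℂ_[p]) : ℂ_[p] :=
  1 / (F : ℂ_[p]) * ∑ a ∈ (Finset.Icc 1 F).filter (fun a => ¬ p ∣ a),
    χ a * (padicPow (angle p a) (1 - s) * bernoulliSeries p F a s)

theorem norm_natCast_le_padicQ_inv {F : ℕ} (hqF : padicQ p ∣ F) :
    ‖(F : ℂ_[p])‖ ≤ (padicQ p : ℝ)⁻¹ :=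
  (PadicComplex.norm_natCast_le_of_dvd hqF).trans PadicComplex.norm_padicQ.le

theorem norm_bernoulli_mul_pow_le {F a : ℕ} (ha : ¬ p ∣ a) (j : ℕ) :
    ‖((bernoulli j : ℚ) : ℂ_[p]) * ((F : ℂ_[p]) / (a : ℂ_[p])) ^ j‖ ≤ p * ‖(F : ℂ_[p])‖ ^ j := by
  rw [norm_mul, norm_pow, norm_div, PadicComplex.norm_natCast_eq_one ha, div_one]
  gcongr
  exact norm_bernoulli_le j

theorem norm_bernoulli_mul_pow_mul_le {F a : ℕ} (hqF : padicQ p ∣ F) (ha : ¬ p ∣ a) (j : ℕ) :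
    ‖((bernoulli j : ℚ) : ℂ_[p]) * ((F : ℂ_[p]) / (a : ℂ_[p])) ^ j‖ * (padicQ p : ℝ) ^ j ≤ p := by
  have hq : (0 : ℝ) < padicQ p := by exact_mod_cast padicQ_pos
  have hF : ‖(F : ℂ_[p])‖ * padicQ p ≤ 1 :=
    (le_div_iff₀ hq).1 (by simpa using norm_natCast_le_padicQ_inv hqF)
  calc _ ≤ (p * ‖(F : ℂ_[p])‖ ^ j) * (padicQ p : ℝ) ^ j := by
        gcongr; exact norm_bernoulli_mul_pow_le ha j
    _ = p * (‖(F : ℂ_[p])‖ * padicQ p) ^ j := by rw [mul_pow]; ring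
    _ ≤ p * 1 := by gcongr; exact pow_le_one₀ (by positivity) hF
    _ = p := mul_one _

theorem hasBoundedExpansion_padicPow_angle {a : ℕ} (ha : ¬ p ∣ a) :
    HasBoundedExpansion (padicLRadius p) (fun s : ℂ_[p] => padicPow (angle p a) (1 - s)) :=
  HasBoundedExpansion.tsum_padicBinom_one_sub_mul
    (norm_sub_one_pow_mul_le (norm_angle_sub_one_le ha))

theorem hasBoundedExpansion_padicLNumerator (χ : DirichletCharacter ℂ_[p] f) {F : ℕ}
    (hqF : padicQ p ∣ F) : HasBoundedExpansion (padicLRadius p) (padicLNumerator χ F) := by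
  have hR := padicLRadius_pos (p := p)
  refine .const_mul _ (.sum hR _ fun a ha => .const_mul _ (.mul hR ?_ ?_))
  · exact hasBoundedExpansion_padicPow_angle (Finset.mem_filter.1 ha).2
  · exact .tsum_padicBinom_one_sub_mul
      (norm_bernoulli_mul_pow_mul_le hqF (Finset.mem_filter.1 ha).2)

theorem bernoulliSeries_one_sub_natCast (F a n : ℕ) :
    bernoulliSeries p F a (1 - n) = ∑ j ∈ Finset.range (n + 1),
      (n.choose j : ℂ_[p]) * (((bernoulli j : ℚ) : ℂ_[p]) * ((F : ℂ_[p]) / (a : ℂ_[p])) ^ j) := by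
  rw [bernoulliSeries, sub_sub_cancel, tsum_padicBinom_natCast_mul]

/-- At `s = 1 - n` the binomial series are finite: `⟨a⟩ ^ n` is `a ^ n ω(a) ^ (-n)`, and the sum over
`j` turns `a ^ n` into the Bernoulli polynomial `F ^ n * B_n(a / F)`. -/
theorem padicLNumerator_one_sub_natCast [NeZero f] {χ : DirichletCharacter ℂ_[p] f}
    (hχ : χ.IsPrimitive) {F : ℕ} (hF : 0 < F) (hqF : padicQ p ∣ F) (hfF : f ∣ F) (k : ℕ) :
    padicLNumerator χ F (1 - (k + 1 : ℕ)) =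
      (1 - teichmullerTwist χ (k + 1) p * (p : ℂ_[p]) ^ k) *
        generalizedBernoulli (k + 1) (teichmullerTwist χ (k + 1)) := by
  have hcond : (χ.mul (teichmullerCharacter p ^ (k + 1))⁻¹).conductor ∣ F :=
    (DirichletCharacter.conductor_dvd_level _).trans (Nat.lcm_dvd hfF hqF)
  have : NeZero (χ.mul (teichmullerCharacter p ^ (k + 1))⁻¹).conductor :=
    ⟨fun h => hF.ne' (by simpa [h] using hcond)⟩
  rw [← sum_filter_not_dvd_bernoulli k _ hF.ne' hcond ((dvd_padicQ p).trans hqF),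
    padicLNumerator, Finset.mul_sum, Finset.mul_sum]
  refine Finset.sum_congr rfl fun a ha => ?_
  have hpa := (Finset.mem_filter.1 ha).2
  have ha0 : (a : ℂ_[p]) ≠ 0 := by
    rw [← norm_ne_zero_iff, PadicComplex.norm_natCast_eq_one hpa]; exact one_ne_zero
  have hB := congrArg (fun x : ℚ => (x : ℂ_[p])) (natCast_pow_mul_bernoulli_eval k hF.ne' a)
  beta_reduce at hB
  rw [Rat.cast_mul, Rat.cast_pow, Rat.cast_natCast] at hB
  rw [mul_left_comm ((F : ℂ_[p]) ^ k), hB, teichmullerTwist_apply hχ _ hpa,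
    bernoulliSeries_one_sub_natCast, sub_sub_cancel,
    padicPow_natCast, angle, div_pow]
  have hsum : (a : ℂ_[p]) ^ (k + 1) * ∑ j ∈ Finset.range (k + 1 + 1),
      ((k + 1).choose j : ℂ_[p]) * (((bernoulli j : ℚ) : ℂ_[p]) * ((F : ℂ_[p]) / (a : ℂ_[p])) ^ j) =
      ∑ j ∈ Finset.range (k + 1 + 1), ((k + 1).choose j : ℂ_[p]) *
        (((bernoulli j : ℚ) : ℂ_[p]) * (F : ℂ_[p]) ^ j * (a : ℂ_[p]) ^ (k + 1 - j)) := by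
    rw [Finset.mul_sum]
    refine Finset.sum_congr rfl fun j hj => ?_
    have hj' : j ≤ k + 1 := Nat.lt_succ_iff.1 (Finset.mem_range.1 hj)
    rw [div_pow, show (a : ℂ_[p]) ^ (k + 1) = a ^ j * a ^ (k + 1 - j) by
      rw [← pow_add, Nat.add_sub_cancel' hj']]
    field_simp
  push_cast
  rw [← hsum]
  ring

theorem sum_filter_not_dvd_eq_zero [NeZero f] {χ : DirichletCharacter ℂ_[p] f} (hχ1 : χ ≠ 1)
    {F : ℕ} (hpF : p ∣ F) (hfF : f ∣ F) :
    ∑ a ∈ (Finset.Icc 1 F).filter (fun a => ¬ p ∣ a), χ a = 0 := by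
  obtain ⟨d, rfl⟩ := hpF
  rw [sum_Icc_one_filter_not_dvd (fun a => χ a) (Fact.out : p.Prime).pos,
    DirichletCharacter.sum_Icc_eq_zero hχ1 hfF, zero_sub, neg_eq_zero]
  simp only [Nat.cast_mul, map_mul, ← Finset.mul_sum]
  by_cases hpf : p ∣ f
  · rw [natCast_apply_eq_zero_of_dvd χ Fact.out hpf dvd_rfl, zero_mul]
  · have hfd : f ∣ d :=
      (Nat.Coprime.symm ((Fact.out : p.Prime).coprime_iff_not_dvd.2 hpf)).dvd_of_dvd_mul_left hfF
    rw [DirichletCharacter.sum_Icc_eq_zero hχ1 hfd, mul_zero]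

theorem padicPow_zero (x : ℂ_[p]) : padicPow x 0 = 1 := by
  simpa using padicPow_natCast x 0

theorem padicLNumerator_one [NeZero f] {χ : DirichletCharacter ℂ_[p] f} (hχ1 : χ ≠ 1)
    {F : ℕ} (hqF : padicQ p ∣ F) (hfF : f ∣ F) : padicLNumerator χ F 1 = 0 := by
  have h : ∀ a, bernoulliSeries p F a 1 = 1 := fun a => by
    simpa using bernoulliSeries_one_sub_natCast (p := p) F a 0
  simp only [padicLNumerator, h, sub_self, padicPow_zero, mul_one]
  rw [sum_filter_not_dvd_eq_zero hχ1 ((dvd_padicQ p).trans hqF) hfF, mul_zero]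

end Numerator

/-! ### Existence and uniqueness -/

section Existence

variable {p : ℕ} [Fact p.Prime] {f : ℕ} {χ : DirichletCharacter ℂ_[p] f}

/-- For every common multiple `F` of `q` and `f`, a `p`-adic `L`-function is obtained by dividing
`padicLNumerator χ F` by `s - 1`. -/
theorem exists_isPadicLFunction [NeZero f] (hχ : χ.IsPrimitive) {F : ℕ} (hF : 0 < F)
    (hqF : padicQ p ∣ F) (hfF : f ∣ F) :
    ∃ L, IsPadicLFunction χ L ∧
      (∀ s, ‖s‖ < padicLRadius p → s ≠ 1 → L s = padicLNumerator χ F s / (s - 1)) ∧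
      (χ ≠ 1 → ContinuousAt L 1) := by
  have hnum := hasBoundedExpansion_padicLNumerator χ hqF
  obtain ⟨L, hL, hLan⟩ : ∃ L : ℂ_[p] → ℂ_[p],
      (∀ s, ‖s‖ < padicLRadius p → s ≠ 1 → L s = padicLNumerator χ F s / (s - 1)) ∧
      (χ ≠ 1 → HasBoundedExpansion (padicLRadius p) L) := by
    by_cases hχ1 : χ = 1
    · exact ⟨fun s => padicLNumerator χ F s / (s - 1), fun _ _ _ => rfl, fun h => absurd hχ1 h⟩
    · obtain ⟨G, hG, hGeq⟩ := hnum.exists_eq_sub_one_mul one_lt_padicLRadius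
        (padicLNumerator_one hχ1 hqF hfF)
      refine ⟨G, fun s hs hs1 => ?_, fun _ => hG⟩
      rw [hGeq s hs, mul_div_cancel_left₀ _ (sub_ne_zero.2 hs1)]
  refine ⟨L, ⟨?_, ?_, ?_⟩, hL, fun h =>
    (hLan h).continuousAt padicLRadius_pos (by simpa using one_lt_padicLRadius)⟩
  · obtain ⟨c, -, hc⟩ := hnum
    refine ⟨c, fun s hs hs1 => ?_⟩
    rw [hL s hs hs1, mul_div_cancel₀ _ (sub_ne_zero.2 hs1)]
    exact hc s hs
  · intro h
    obtain ⟨c, -, hc⟩ := hLan h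
    exact ⟨c, hc⟩
  · intro n hn
    obtain ⟨k, rfl⟩ := Nat.exists_eq_add_of_le' hn
    have hk : ((k + 1 : ℕ) : ℂ_[p]) ≠ 0 := Nat.cast_ne_zero.2 k.succ_ne_zero
    have hnorm : ‖(1 : ℂ_[p]) - (k + 1 : ℕ)‖ < padicLRadius p := by
      refine lt_of_le_of_lt ?_ one_lt_padicLRadius
      exact (norm_sub_le_max_norm _ _).trans
        (max_le norm_one.le (IsUltrametricDist.norm_natCast_le_one _ _))
    rw [hL _ hnorm (fun h => hk (by linear_combination -h)),
      padicLNumerator_one_sub_natCast hχ hF hqF hfF,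
      Nat.add_sub_cancel, show (1 : ℂ_[p]) - (k + 1 : ℕ) - 1 = -((k + 1 : ℕ) : ℂ_[p]) by ring]
    rw [div_neg, neg_mul, neg_div]

/-- Two power series on the disc that agree at the points `1 - n`, `n ≥ 1`, have the same
coefficients: the points `-p ^ k` among them accumulate at `0`. -/
theorem coeff_eq_of_eq_at_one_sub_natCast {c c' : ℕ → ℂ_[p]} {g g' : ℂ_[p] → ℂ_[p]}
    (hc : ∀ s, ‖s‖ < padicLRadius p → s ≠ 1 → HasSum (fun n => c n * s ^ n) (g s))
    (hc' : ∀ s, ‖s‖ < padicLRadius p → s ≠ 1 → HasSum (fun n => c' n * s ^ n) (g' s))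
    (h : ∀ n : ℕ, 1 ≤ n → g (1 - n) = g' (1 - n)) : c = c' := by
  have hp := one_lt_cast_prime (p := p)
  have hp0 : (p : ℂ_[p]) ≠ 0 := Nat.cast_ne_zero.2 (Fact.out : p.Prime).ne_zero
  have hsum : ∀ s : ℂ_[p], ‖s‖ < padicLRadius p → s ≠ 1 →
      HasSum (fun n => (c - c') n * s ^ n) (g s - g' s) := fun s hs hs1 => by
    simpa [sub_mul] using (hc s hs hs1).sub (hc' s hs hs1)
  refine sub_eq_zero.1 (coeff_eq_zero_of_hasSum_zero (z := fun k => -(p : ℂ_[p]) ^ k) ?_ ?_ ?_ ?_)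
  · filter_upwards [Metric.ball_mem_nhds (0 : ℂ_[p]) one_pos] with s hs
    have hs' : ‖s‖ < 1 := by simpa using hs
    exact (hsum s (hs'.trans one_lt_padicLRadius) fun h => by simp [h] at hs').summable
  · have : ‖(p : ℂ_[p])‖ < 1 := by
      rw [PadicComplex.norm_p]; exact inv_lt_one_of_one_lt₀ hp
    simpa using (tendsto_pow_atTop_nhds_zero_of_norm_lt_one this).neg
  · intro k; exact neg_ne_zero.2 (pow_ne_zero k hp0)
  · intro k
    have e : -(p : ℂ_[p]) ^ k = 1 - ((p ^ k + 1 : ℕ) : ℂ_[p]) := by push_cast; ring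
    have hn : ((p ^ k + 1 : ℕ) : ℂ_[p]) ≠ 0 := Nat.cast_ne_zero.2 (Nat.succ_ne_zero _)
    have hnorm : ‖-(p : ℂ_[p]) ^ k‖ < padicLRadius p := by
      refine lt_of_le_of_lt ?_ one_lt_padicLRadius
      rw [norm_neg, norm_pow]
      exact pow_le_one₀ (norm_nonneg _) (IsUltrametricDist.norm_natCast_le_one _ _)
    have h1 : -(p : ℂ_[p]) ^ k ≠ 1 := by rw [e]; exact fun h => hn (by linear_combination -h)
    rw [(hsum _ hnorm h1).tsum_eq, e, h _ (by omega), sub_self]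

theorem IsPadicLFunction.eq_of_ne_one {L L' : ℂ_[p] → ℂ_[p]} (hL : IsPadicLFunction χ L)
    (hL' : IsPadicLFunction χ L') {s : ℂ_[p]} (hs : ‖s‖ < padicLRadius p) (hs1 : s ≠ 1) :
    L s = L' s := by
  obtain ⟨c, hc⟩ := hL.meromorphic
  obtain ⟨c', hc'⟩ := hL'.meromorphic
  have h := coeff_eq_of_eq_at_one_sub_natCast hc hc' fun n hn => by
    rw [hL.interpolation n hn, hL'.interpolation n hn]
  exact mul_left_cancel₀ (sub_ne_zero.2 hs1) ((hc s hs hs1).unique (h ▸ hc' s hs hs1))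

theorem IsPadicLFunction.eq_of_char_ne_one {L L' : ℂ_[p] → ℂ_[p]} (hL : IsPadicLFunction χ L)
    (hL' : IsPadicLFunction χ L') (hχ1 : χ ≠ 1) {s : ℂ_[p]} (hs : ‖s‖ < padicLRadius p) :
    L s = L' s := by
  obtain ⟨c, hc⟩ := hL.analytic hχ1
  obtain ⟨c', hc'⟩ := hL'.analytic hχ1
  have h := coeff_eq_of_eq_at_one_sub_natCast (fun s hs _ => hc s hs) (fun s hs _ => hc' s hs)
    fun n hn => by rw [hL.interpolation n hn, hL'.interpolation n hn]
  exact (hc s hs).unique (h ▸ hc' s hs)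

end Existence

/-! ### The estimate -/

section Estimate

variable {p : ℕ} [Fact p.Prime] {f : ℕ} {χ : DirichletCharacter ℂ_[p] f}

theorem angle_sub_eq {F a : ℕ} (hqF : padicQ p ∣ F) (haF : a ≤ F) (ha : ¬ p ∣ a) :
    angle p (F - a) = angle p a - F / teichmullerCharacter p a := by
  have hω : teichmullerCharacter p a ≠ 0 := by
    rw [← norm_ne_zero_iff, norm_teichmullerCharacter ha]; exact one_ne_zero
  have hc : ((F - a : ℕ) : ZMod (padicQ p)) = -1 * a := by
    rw [Nat.cast_sub haF, (ZMod.natCast_eq_zero_iff _ _).2 hqF]; ring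
  rw [angle, angle, hc, map_mul, teichmullerCharacter_neg_one, Nat.cast_sub haF]
  field_simp
  ring

/-- The term of index `j = 1`: up to `O(F)`, the contributions of `a` and `F - a` cancel, because
`χ` is even. -/
theorem norm_two_mul_sum_div_le (heven : χ.Even) {F : ℕ} (hqF : padicQ p ∣ F) (hfF : f ∣ F)
    {t : ℂ_[p]} (ht : ‖t‖ < padicLRadius p) :
    ‖2 * ∑ a ∈ (Finset.Icc 1 F).filter (fun a => ¬ p ∣ a),
      χ a * (padicPow (angle p a) t / a)‖ ≤ padicLRadius p * ‖(F : ℂ_[p])‖ := by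
  have hpF : p ∣ F := (dvd_padicQ p).trans hqF
  have hR := one_lt_padicLRadius (p := p)
  have hmem : ∀ a ∈ (Finset.Icc 1 F).filter (fun a => ¬ p ∣ a),
      a < F ∧ F - a ∈ (Finset.Icc 1 F).filter (fun a => ¬ p ∣ a) := by
    intro a ha
    obtain ⟨ha1, hpa⟩ := Finset.mem_filter.1 ha
    rw [Finset.mem_Icc] at ha1
    have hne : a ≠ F := fun h => hpa (h ▸ hpF)
    refine ⟨by omega, Finset.mem_filter.2 ⟨Finset.mem_Icc.2 ⟨by omega, by omega⟩, fun h => ?_⟩⟩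
    exact hpa ((Nat.dvd_sub_iff_right ha1.2 hpF).1 h)
  have hrefl : ∑ a ∈ (Finset.Icc 1 F).filter (fun a => ¬ p ∣ a),
        χ a * (padicPow (angle p a) t / a) =
      ∑ a ∈ (Finset.Icc 1 F).filter (fun a => ¬ p ∣ a),
        χ a * (padicPow (angle p (F - a)) t / (F - a : ℕ)) := by
    refine Finset.sum_nbij' (fun a => F - a) (fun a => F - a) (fun a ha => (hmem a ha).2)
      (fun a ha => (hmem a ha).2) (fun a ha => Nat.sub_sub_self (hmem a ha).1.le)
      (fun a ha => Nat.sub_sub_self (hmem a ha).1.le) fun a ha => ?_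
    rw [Nat.sub_sub_self (hmem a ha).1.le, Nat.cast_sub (hmem a ha).1.le (R := ZMod f),
      (ZMod.natCast_eq_zero_iff _ _).2 hfF, zero_sub, heven.eval_neg]
  rw [two_mul]
  nth_rw 2 [hrefl]
  rw [← Finset.sum_add_distrib]
  refine IsUltrametricDist.norm_sum_le_of_forall_le_of_nonneg (by positivity) fun a ha => ?_
  obtain ⟨haF, hmem'⟩ := hmem a ha
  have hpa := (Finset.mem_filter.1 ha).2
  have hpa' := (Finset.mem_filter.1 hmem').2
  have n1 := PadicComplex.norm_natCast_eq_one (p := p) hpa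
  have n2 := PadicComplex.norm_natCast_eq_one (p := p) hpa'
  have a0 : (a : ℂ_[p]) ≠ 0 := by rw [← norm_ne_zero_iff, n1]; exact one_ne_zero
  have a0' : ((F - a : ℕ) : ℂ_[p]) ≠ 0 := by rw [← norm_ne_zero_iff, n2]; exact one_ne_zero
  have key : padicPow (angle p a) t / a + padicPow (angle p (F - a)) t / (F - a : ℕ) =
      (padicPow (angle p (F - a)) t - padicPow (angle p a) t) / (F - a : ℕ) +
      padicPow (angle p a) t * F / (a * (F - a : ℕ)) := by
    have : (F : ℂ_[p]) = a + (F - a : ℕ) := by rw [Nat.cast_sub haF.le]; ring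
    rw [this]
    field_simp
    ring
  rw [← mul_add, norm_mul]
  refine (mul_le_of_le_one_left (norm_nonneg _) (DirichletCharacter.norm_le_one χ _)).trans ?_
  rw [key]
  refine (IsUltrametricDist.norm_add_le_max _ _).trans (max_le ?_ ?_)
  · rw [norm_div, n2, div_one]
    refine (norm_padicPow_sub_padicPow_le (norm_angle_sub_one_le hpa')
      (norm_angle_sub_one_le hpa) ht).trans ?_
    rw [angle_sub_eq hqF haF.le hpa, sub_sub_cancel_left, norm_neg, norm_div,
      norm_teichmullerCharacter hpa, div_one]
  · rw [norm_div, norm_mul, norm_mul, n1, n2, mul_one, div_one]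
    gcongr
    exact (norm_padicPow_le_one (norm_angle_sub_one_le hpa) ht.le).trans hR.le

/-- The part of `(bernoulliSeries p F a s - 1) / (s - 1)` that comes from the indices `j ≥ 2`. -/
theorem norm_bernoulliSeries_tail_le {F a : ℕ} (hqF : padicQ p ∣ F) (ha : ¬ p ∣ a) {s : ℂ_[p]}
    (hs : ‖s‖ < padicLRadius p) (hs1 : s ≠ 1) :
    ‖(bernoulliSeries p F a s - 1) / (s - 1) - F / (2 * a)‖ ≤
      padicQ p * p * ‖(F : ℂ_[p])‖ ^ 2 := by
  have hq : (0 : ℝ) < padicQ p := by exact_mod_cast padicQ_pos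
  have hs0 : s - 1 ≠ 0 := sub_ne_zero.2 hs1
  have ha0 : (a : ℂ_[p]) ≠ 0 := by
    rw [← norm_ne_zero_iff, PadicComplex.norm_natCast_eq_one ha]; exact one_ne_zero
  have hs' : ‖1 - s‖ < padicLRadius p :=
    (norm_sub_le_max_norm _ _).trans_lt (max_lt (by simpa using one_lt_padicLRadius) hs)
  have hF := norm_natCast_le_padicQ_inv (p := p) hqF
  have hsum := summable_padicBinom_mul (norm_bernoulli_mul_pow_mul_le hqF ha) hs'
  have hsplit : bernoulliSeries p F a s = 1 + (1 - s) * (-1 / 2 * (F / a)) +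
      ∑' j, padicBinom (1 - s) (j + 2) *
        (((bernoulli (j + 2) : ℚ) : ℂ_[p]) * ((F : ℂ_[p]) / (a : ℂ_[p])) ^ (j + 2)) := by
    rw [bernoulliSeries, ← hsum.sum_add_tsum_nat_add 2]
    simp [Finset.sum_range_succ, padicBinom]
  have heq : (bernoulliSeries p F a s - 1) / (s - 1) - F / (2 * a) =
      (∑' j, padicBinom (1 - s) (j + 2) *
        (((bernoulli (j + 2) : ℚ) : ℂ_[p]) * ((F : ℂ_[p]) / (a : ℂ_[p])) ^ (j + 2))) / (s - 1) := by
    rw [hsplit]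
    field_simp
    ring
  rw [heq, norm_div, div_le_iff₀ (norm_pos_iff.2 hs0)]
  refine IsUltrametricDist.norm_tsum_le_of_forall_le fun j => ?_
  have h1 := norm_padicBinom_succ_le_padicQ_pow hs'.le (j + 1)
  have h2 := norm_bernoulli_mul_pow_le (p := p) (F := F) ha (j + 2)
  rw [norm_sub_rev 1 s] at h1
  rw [norm_mul]
  calc _ ≤ (‖s - 1‖ * (padicQ p : ℝ) ^ (j + 1)) * (p * ‖(F : ℂ_[p])‖ ^ (j + 2)) := by gcongr
    _ = ‖s - 1‖ * padicQ p * p * ‖(F : ℂ_[p])‖ ^ 2 * ((padicQ p : ℝ) * ‖(F : ℂ_[p])‖) ^ j := by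
        rw [mul_pow]; ring
    _ ≤ ‖s - 1‖ * padicQ p * p * ‖(F : ℂ_[p])‖ ^ 2 * ((padicQ p : ℝ) * (padicQ p : ℝ)⁻¹) ^ j := by
        gcongr
    _ = padicQ p * p * ‖(F : ℂ_[p])‖ ^ 2 * ‖s - 1‖ := by
        rw [mul_inv_cancel₀ hq.ne', one_pow]; ring

theorem norm_div_padicQ_mul (F : ℕ) :
    ‖(F : ℂ_[p]) / ((padicQ p : ℂ_[p]) * (p : ℂ_[p]))‖ = padicQ p * p * ‖(F : ℂ_[p])‖ := by
  rw [norm_div, norm_mul, PadicComplex.norm_padicQ, PadicComplex.norm_p, ← mul_inv, div_inv_eq_mul,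
    mul_comm]

/-- For `p = 2` this is an equality: `2 = 4 * 2 / 4`. -/
theorem padicLRadius_le_mul_norm_four :
    padicLRadius p ≤ padicQ p * p * ‖((4 : ℕ) : ℂ_[p])‖ := by
  have hp := one_lt_cast_prime (p := p)
  by_cases h : p = 2
  · subst h
    have h4 := PadicComplex.norm_padicQ (p := 2)
    have hq : padicQ 2 = 4 := rfl
    rw [hq] at h4
    rw [h4, padicLRadius, hq]
    norm_num [Real.rpow_neg_one]
  · have h4 : ¬ p ∣ 4 := fun hd => h ((Nat.prime_dvd_prime_iff_eq Fact.out Nat.prime_two).1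
      ((Fact.out : p.Prime).dvd_of_dvd_pow (show p ∣ 2 ^ 2 by simpa using hd)))
    rw [PadicComplex.norm_natCast_eq_one h4, mul_one]
    refine padicLRadius_le_padicQ.trans (le_mul_of_one_le_right (by positivity) hp.le)

/-- The difference of the two sides consists of the terms `j = 1`, in which evenness of `χ` gives a
factor `F`, and the terms `j ≥ 2`, each of which satisfies the bound. -/
theorem norm_padicLNumerator_div_sub_le (heven : χ.Even) {F : ℕ} (hF : 0 < F)
    (hqF : padicQ p ∣ F) (hfF : f ∣ F) {s : ℂ_[p]} (hs : ‖s‖ < padicLRadius p) (hs1 : s ≠ 1) :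
    ‖padicLNumerator χ F s / (s - 1) - kubotaLeopoldtSum χ F s‖ ≤
      ‖(F : ℂ_[p]) / ((padicQ p : ℂ_[p]) * (p : ℂ_[p]))‖ := by
  have hF0 : (F : ℂ_[p]) ≠ 0 := Nat.cast_ne_zero.2 hF.ne'
  have hFn : 0 < ‖(F : ℂ_[p])‖ := norm_pos_iff.2 hF0
  have hs0 : s - 1 ≠ 0 := sub_ne_zero.2 hs1
  have hs' : ‖1 - s‖ < padicLRadius p :=
    (norm_sub_le_max_norm _ _).trans_lt (max_lt (by simpa using one_lt_padicLRadius) hs)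
  rw [norm_div_padicQ_mul]
  set A := (Finset.Icc 1 F).filter (fun a => ¬ p ∣ a) with hA
  set S := ∑ a ∈ A, χ a * (padicPow (angle p a) (1 - s) / a) with hS
  set E : ℕ → ℂ_[p] := fun a => (bernoulliSeries p F a s - 1) / (s - 1) - F / (2 * a) with hE
  have hsplit : padicLNumerator χ F s / (s - 1) - kubotaLeopoldtSum χ F s =
      2 * S / (4 : ℕ) + 1 / F * ∑ a ∈ A, χ a * (padicPow (angle p a) (1 - s) * E a) := by
    rw [padicLNumerator, kubotaLeopoldtSum, hS, Finset.mul_sum, Finset.mul_sum, Finset.mul_sum,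
      Finset.mul_sum, Finset.sum_div, Finset.sum_div, ← Finset.sum_sub_distrib,
      ← Finset.sum_add_distrib]
    refine Finset.sum_congr rfl fun a ha => ?_
    have ha0 : (a : ℂ_[p]) ≠ 0 := by
      rw [← norm_ne_zero_iff, PadicComplex.norm_natCast_eq_one (Finset.mem_filter.1 ha).2]
      exact one_ne_zero
    simp only [hE]
    push_cast
    field_simp
    ring
  rw [hsplit]
  -- `S / 2` is written as `(2 * S) / 4`, because the cancellation lemma bounds `2 * S`.
  refine (IsUltrametricDist.norm_add_le_max _ _).trans (max_le ?_ ?_)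
  · rw [norm_div, div_le_iff₀ (norm_pos_iff.2 (Nat.cast_ne_zero.2 four_ne_zero))]
    refine (norm_two_mul_sum_div_le heven hqF hfF hs').trans ?_
    have := mul_le_mul_of_nonneg_right (padicLRadius_le_mul_norm_four (p := p)) hFn.le
    linarith
  · rw [norm_mul, norm_div, norm_one, one_div, inv_mul_le_iff₀ hFn]
    refine IsUltrametricDist.norm_sum_le_of_forall_le_of_nonneg (by positivity) fun a ha => ?_
    have hpa := (Finset.mem_filter.1 ha).2
    have h1 := norm_padicPow_le_one (norm_angle_sub_one_le hpa) hs'.le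
    have h2 := norm_bernoulliSeries_tail_le hqF hpa hs hs1
    rw [norm_mul, norm_mul]
    calc _ ≤ 1 * (1 * (padicQ p * p * ‖(F : ℂ_[p])‖ ^ 2)) := by
          gcongr
          exact DirichletCharacter.norm_le_one χ _
      _ = _ := by ring

/-- For `χ ≠ 1`, the sum `∑ χ(a) ⟨a⟩ ^ (1 - s)` vanishes at `s = 1`. -/
theorem exists_tendsto_kubotaLeopoldtSum [NeZero f] (hχ1 : χ ≠ 1) {F : ℕ}
    (hqF : padicQ p ∣ F) (hfF : f ∣ F) :
    ∃ l, Tendsto (kubotaLeopoldtSum χ F) (𝓝[≠] 1) (𝓝 l) := by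
  have hR := one_lt_padicLRadius (p := p)
  have hnum : HasBoundedExpansion (padicLRadius p) (fun s : ℂ_[p] => 1 / (F : ℂ_[p]) *
      ∑ a ∈ (Finset.Icc 1 F).filter (fun a => ¬ p ∣ a), χ a * padicPow (angle p a) (1 - s)) :=
    .const_mul _ (.sum padicLRadius_pos _ fun a ha => .const_mul _
      (hasBoundedExpansion_padicPow_angle (Finset.mem_filter.1 ha).2))
  obtain ⟨G, hG, hGeq⟩ := hnum.exists_eq_sub_one_mul hR (by
    simp only [sub_self, padicPow_zero, mul_one]
    rw [sum_filter_not_dvd_eq_zero hχ1 ((dvd_padicQ p).trans hqF) hfF, mul_zero])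
  have h1 : ‖(1 : ℂ_[p])‖ < padicLRadius p := by simpa using hR
  refine ⟨G 1, (((hG.continuousAt padicLRadius_pos h1).tendsto).mono_left
    nhdsWithin_le_nhds).congr' ?_⟩
  have hball : ∀ᶠ s in 𝓝[≠] (1 : ℂ_[p]), ‖s‖ < padicLRadius p :=
    (continuous_norm.continuousAt.eventually (gt_mem_nhds h1)).filter_mono nhdsWithin_le_nhds
  filter_upwards [hball, self_mem_nhdsWithin] with s hs hs1
  have hs0 : s - 1 ≠ 0 := sub_ne_zero.2 hs1
  rw [kubotaLeopoldtSum, mul_right_comm, hGeq s hs]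
  field_simp

end Estimate

theorem mainTheorem5 (p : ℕ) [Fact p.Prime] (f : ℕ) [NeZero f]
    (χ : DirichletCharacter ℂ_[p] f) (hχ : χ.IsPrimitive) (heven : χ.Even) :
    IsPadicLFunction χ (padicLFunction χ) ∧
    ∀ F : ℕ, 0 < F → padicQ p ∣ F → f ∣ F →
      (∀ s : ℂ_[p], ‖s‖ < padicLRadius p → s ≠ 1 →
        ‖padicLFunction χ s - kubotaLeopoldtSum χ F s‖ ≤
          ‖(F : ℂ_[p]) / ((padicQ p : ℂ_[p]) * (p : ℂ_[p]))‖) ∧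
      (χ ≠ 1 → ∃ l : ℂ_[p], Tendsto (kubotaLeopoldtSum χ F) (𝓝[≠] 1) (𝓝 l) ∧
        ‖padicLFunction χ 1 - l‖ ≤
          ‖(F : ℂ_[p]) / ((padicQ p : ℂ_[p]) * (p : ℂ_[p]))‖) := by
  have hmain : IsPadicLFunction χ (padicLFunction χ) := by
    obtain ⟨L, hL, -⟩ := exists_isPadicLFunction hχ
      (Nat.mul_pos (padicQ_pos (p := p)) (NeZero.pos f)) (dvd_mul_right _ _) (dvd_mul_left _ _)
    have h : ∃ L, IsPadicLFunction χ L := ⟨L, hL⟩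
    rw [padicLFunction, dif_pos h]
    exact h.choose_spec
  refine ⟨hmain, fun F hF hqF hfF => ?_⟩
  obtain ⟨L, hL, hLeq, hLcont⟩ := exists_isPadicLFunction hχ hF hqF hfF
  have hest : ∀ s : ℂ_[p], ‖s‖ < padicLRadius p → s ≠ 1 →
      ‖L s - kubotaLeopoldtSum χ F s‖ ≤
        ‖(F : ℂ_[p]) / ((padicQ p : ℂ_[p]) * (p : ℂ_[p]))‖ := fun s hs hs1 => by
    rw [hLeq s hs hs1]
    exact norm_padicLNumerator_div_sub_le heven hF hqF hfF hs hs1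
  refine ⟨fun s hs hs1 => hmain.eq_of_ne_one hL hs hs1 ▸ hest s hs hs1, fun hχ1 => ?_⟩
  obtain ⟨l, hl⟩ := exists_tendsto_kubotaLeopoldtSum hχ1 hqF hfF
  have h1 : ‖(1 : ℂ_[p])‖ < padicLRadius p := by simpa using one_lt_padicLRadius
  refine ⟨l, hl, ?_⟩
  rw [hmain.eq_of_char_ne_one hL hχ1 h1]
  have hball : ∀ᶠ s in 𝓝[≠] (1 : ℂ_[p]), ‖s‖ < padicLRadius p :=
    (continuous_norm.continuousAt.eventually (gt_mem_nhds h1)).filter_mono nhdsWithin_le_nhds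
  refine le_of_tendsto
    ((((hLcont hχ1).tendsto.mono_left nhdsWithin_le_nhds).sub hl).norm) ?_
  filter_upwards [hball, self_mem_nhdsWithin] with s hs hs1
  exact hest s hs hs1
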